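/- Let $k\ge 1$ be an integer and let $G$ be a simple graph that is locally finite (every vertex has finite degree) and quasi-transitive (the automorphism group of $G$ has finitely many orbits on $V(G)$). Then $G$ cannot have exactly one end of degree exactly $k$; that is, the number of ends of $G$ of degree $k$ is not equal to $1$. Here a ray of $G$ is an infinite simple one-way path $(v_0,v_1,v_2,\ldots)$ in $G$. Two rays $P,P'$ are equivalent if for every finite set $S\subseteq V(G)$ there is a connected component of $G-S$ that contains infinitely many vertices of both $P$ and $P'$. The ends of $G$ are the equivalence classes of rays, and the degree of an end $\omega$ is the supremum, in $\mathbb{N}\cup\{\infty\}$, of the cardinalities of families of pairwise vertex-disjoint rays that belong to $\omega$. -/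

import Mathlib

namespace SimpleGraph

variable {V : Type*}

/-- A ray in `G`: an infinite simple one-way path `v 0, v 1, v 2, …`. -/
structure Ray (G : SimpleGraph V) where
  /-- The sequence of vertices of the ray. -/
  vert : ℕ → V
  injective : Function.Injective vert
  adj : ∀ n, G.Adj (vert n) (vert (n + 1))

namespace Ray

variable {G : SimpleGraph V}

/-- The set of vertices of a ray. -/
def support (P : G.Ray) : Set V := Set.range P.vert

/-- Two rays are equivalent if for every finite set `S` of vertices there is a component of
`G - S` that contains infinitely many vertices of both rays. -/
def Equivalent (P Q : G.Ray) : Prop :=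
  ∀ S : Set V, S.Finite → ∃ C : G.ComponentCompl S,
    ((C : Set V) ∩ P.support).Infinite ∧ ((C : Set V) ∩ Q.support).Infinite

theorem exists_tail (P : G.Ray) {S : Set V} (hS : S.Finite) :
    ∃ (N : ℕ) (C : G.ComponentCompl S), ∀ n, N ≤ n → P.vert n ∈ (C : Set V) := by
  have hfin : (P.vert ⁻¹' S).Finite := hS.preimage P.injective.injOn
  obtain ⟨M, hM⟩ := hfin.bddAbove
  have hout : ∀ n, M + 1 ≤ n → P.vert n ∉ S := fun n hn h => by
    have := hM h
    omega
  refine ⟨M + 1, G.componentComplMk (hout (M + 1) le_rfl), fun n hn => ?_⟩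
  induction n, hn using Nat.le_induction with
  | base => exact G.componentComplMk_mem _
  | succ n hn ih =>
    exact ComponentCompl.mem_of_adj _ _ ih (hout _ (by omega)) (P.adj n)

theorem eq_of_infinite (P : G.Ray) {S : Set V} {C D : G.ComponentCompl S} {N : ℕ}
    (hC : ∀ n, N ≤ n → P.vert n ∈ (C : Set V)) (hD : ((D : Set V) ∩ P.support).Infinite) :
    D = C := by
  obtain ⟨x, ⟨hxD, n, rfl⟩, hx⟩ := hD.exists_notMem_finite ((Set.finite_Iio N).image P.vert)
  have hn : N ≤ n := by
    by_contra h
    exact hx ⟨n, not_le.mp h, rfl⟩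
  by_contra hne
  exact Set.disjoint_left.mp (ComponentCompl.pairwise_disjoint hne) hxD (hC n hn)

theorem infinite_of_tail (P : G.Ray) {S : Set V} {C : G.ComponentCompl S} {N : ℕ}
    (hC : ∀ n, N ≤ n → P.vert n ∈ (C : Set V)) : ((C : Set V) ∩ P.support).Infinite := by
  refine ((Set.Ici_infinite N).image P.injective.injOn).mono ?_
  rintro _ ⟨n, hn, rfl⟩
  exact ⟨hC n hn, n, rfl⟩

theorem equivalent_equivalence : Equivalence (Equivalent (G := G)) where
  refl P := fun S hS => by
    obtain ⟨N, C, hC⟩ := P.exists_tail hS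
    exact ⟨C, P.infinite_of_tail hC, P.infinite_of_tail hC⟩
  symm h := fun S hS => by
    obtain ⟨C, h₁, h₂⟩ := h S hS
    exact ⟨C, h₂, h₁⟩
  trans {P Q R} h h' := fun S hS => by
    obtain ⟨C, h₁, h₂⟩ := h S hS
    obtain ⟨D, h₃, h₄⟩ := h' S hS
    obtain ⟨N, E, hE⟩ := Q.exists_tail hS
    obtain rfl := Q.eq_of_infinite hE h₂
    obtain rfl := Q.eq_of_infinite hE h₃
    exact ⟨_, h₁, h₄⟩

/-- The equivalence of rays, as a setoid. -/
instance setoid (G : SimpleGraph V) : Setoid G.Ray := ⟨Equivalent, equivalent_equivalence⟩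

end Ray

/-- The ends of `G`: the equivalence classes of rays. -/
def RayEnd (G : SimpleGraph V) : Type _ := Quotient (Ray.setoid G)

/-- The set of rays that belong to an end. -/
def RayEnd.rays {G : SimpleGraph V} (ω : G.RayEnd) : Set G.Ray :=
  {P | Quotient.mk (Ray.setoid G) P = ω}

/-- The degree of an end: the supremum in `ℕ ∪ {∞}` of the cardinalities of families of
pairwise (vertex-)disjoint rays that belong to the end. -/
noncomputable def RayEnd.degree {G : SimpleGraph V} (ω : G.RayEnd) : ℕ∞ :=
  ⨆ F ∈ {F : Set G.Ray | F ⊆ ω.rays ∧ F.PairwiseDisjoint Ray.support}, F.encard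

/-- `G` is quasi-transitive: its automorphism group has finitely many orbits of vertices. -/
def IsQuasiTransitive (G : SimpleGraph V) : Prop :=
  Finite (MulAction.orbitRel.Quotient (G ≃g G) V)

end SimpleGraph

/-! Suppose ω is the only end of degree k. Automorphisms preserve degrees, so all of them fix ω. Fix
k disjoint rays in ω. By a Menger argument (`exists_separator`) every finite set is separated from ω
by at most k vertices. If that set contains the starts of the rays, the separator consists of
exactly one vertex of each ray (`exists_isCut`). Iterating gives an infinite nested sequence of such
cuts.

Each cut is a tight separator of two neighbours of one of its vertices, and by local finiteness a
given vertex has only finitely many such separators of size k. As there are finitely many orbits,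
two of the cuts, S and a deeper S', are translates of each other (`exists_cut_translate`).

An automorphism h with h S' = S fixes ω but pushes S' away from it. Read backwards, the ray segments
between S and S' link S' to h S', and their translates by powers of h concatenate to k disjoint
rays. These rays share an end, because far translates of a connected finite set overlap
consecutively and avoid any given finite set. The end is not ω, since the rays leave the side of S'.
It has no k + 1 disjoint rays, since all of them would cross a single translate of S', which has k
vertices. So a second end of degree k exists (`exists_other_end`). -/

open scoped Pointwise

/-! ### Walks that avoid a set -/

namespace SimpleGraph

variable {V : Type*} {G : SimpleGraph V}

/-- `u` and `v` are joined by a walk of `G` that avoids `S`. -/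
def JoinedOff (G : SimpleGraph V) (S : Set V) (u v : V) : Prop :=
  ∃ p : G.Walk u v, ∀ x ∈ p.support, x ∉ S

namespace JoinedOff

variable {S T X : Set V} {u v w : V}

theorem refl (h : u ∉ S) : G.JoinedOff S u u :=
  ⟨Walk.nil, by simpa using h⟩

theorem of_adj (h : G.Adj u v) (hu : u ∉ S) (hv : v ∉ S) : G.JoinedOff S u v :=
  ⟨h.toWalk, by simp [hu, hv]⟩

theorem symm (h : G.JoinedOff S u v) : G.JoinedOff S v u := by
  obtain ⟨p, hp⟩ := h
  exact ⟨p.reverse, fun x hx => hp x (by simpa using hx)⟩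

theorem trans (h : G.JoinedOff S u v) (h' : G.JoinedOff S v w) : G.JoinedOff S u w := by
  obtain ⟨p, hp⟩ := h
  obtain ⟨q, hq⟩ := h'
  refine ⟨p.append q, fun x hx => ?_⟩
  rcases (Walk.mem_support_append_iff _ _).1 hx with h | h
  exacts [hp x h, hq x h]

theorem mono (hST : S ⊆ T) (h : G.JoinedOff T u v) : G.JoinedOff S u v := by
  obtain ⟨p, hp⟩ := h
  exact ⟨p, fun x hx hS => hp x hx (hST hS)⟩

theorem left_notMem (h : G.JoinedOff S u v) : u ∉ S := by
  obtain ⟨p, hp⟩ := h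
  exact hp _ p.start_mem_support

theorem right_notMem (h : G.JoinedOff S u v) : v ∉ S :=
  h.symm.left_notMem

/-- A walk avoiding `S` that starts in a set closed under adjacency off `S` stays in this set. -/
theorem within (h : G.JoinedOff S u v) (hX : ∀ x ∈ X, ∀ y, G.Adj x y → y ∉ S → y ∈ X)
    (hu : u ∈ X) : G.JoinedOff (S ∪ Xᶜ) u v := by
  obtain ⟨p, hp⟩ := h
  refine ⟨p, ?_⟩
  induction p with
  | nil => simpa [hu] using hp
  | cons hadj p ih =>
    simp only [Walk.support_cons, List.mem_cons, forall_eq_or_imp] at hp ⊢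
    refine ⟨by simpa [hu] using hp.1, ih ?_ hp.2⟩
    exact hX _ hu _ hadj (hp.2 _ p.start_mem_support)

theorem mem_of_closed (h : G.JoinedOff S u v)
    (hX : ∀ x ∈ X, ∀ y, G.Adj x y → y ∉ S → y ∈ X) (hu : u ∈ X) : v ∈ X := by
  have := (h.within hX hu).right_notMem
  simp only [Set.mem_union, Set.mem_compl_iff, not_or, not_not] at this
  exact this.2

theorem smul (g : G ≃g G) (h : G.JoinedOff S u v) : G.JoinedOff (g • S) (g • u) (g • v) := by
  obtain ⟨p, hp⟩ := h
  refine ⟨p.map g.toHom, fun x hx => ?_⟩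
  rw [Walk.support_map, List.mem_map] at hx
  obtain ⟨y, hy, rfl⟩ := hx
  exact fun h => hp y hy (Set.smul_mem_smul_set_iff.1 h)

theorem of_componentCompl {C : G.ComponentCompl S} (hu : u ∈ (C : Set V)) (hv : v ∈ (C : Set V)) :
    G.JoinedOff S u v := by
  obtain ⟨hu', rfl⟩ := hu
  obtain ⟨hv', hC⟩ := hv
  obtain ⟨p⟩ := ConnectedComponent.exact hC.symm
  refine ⟨p.map (Embedding.induce Sᶜ).toHom, fun x hx => ?_⟩
  obtain ⟨y, hy, rfl⟩ := List.mem_map.1 (by rw [← Walk.support_map]; exact hx)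
  exact y.2

theorem mem_componentCompl {C : G.ComponentCompl S} (h : G.JoinedOff S u v)
    (hu : u ∈ (C : Set V)) : v ∈ (C : Set V) :=
  h.mem_of_closed (fun x hx y hxy hy => ComponentCompl.mem_of_adj x y hx hy hxy) hu

end JoinedOff

/-! ### The side of a separator in which an end lives -/

namespace Ray

variable {P Q : G.Ray} {S T : Set V} {u v : V}

/-- The set of vertices that can be joined off `S` to a tail of `P`; for finite `S` this is the
component of `G - S` in which the end of `P` lives. -/
def endSide (P : G.Ray) (S : Set V) : Set V :=
  {v | ∃ N, ∀ n, N ≤ n → G.JoinedOff S v (P.vert n)}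

theorem joinedOff_of_forall (P : G.Ray) {m n : ℕ} (hmn : m ≤ n)
    (h : ∀ l, m ≤ l → l ≤ n → P.vert l ∉ S) : G.JoinedOff S (P.vert m) (P.vert n) := by
  induction n, hmn using Nat.le_induction with
  | base => exact JoinedOff.refl (h m le_rfl le_rfl)
  | succ n hn ih =>
    exact (ih fun l h₁ h₂ => h l h₁ (by omega)).trans
      (JoinedOff.of_adj (P.adj n) (h n hn (by omega)) (h (n + 1) (by omega) le_rfl))

theorem notMem_of_mem_endSide (h : v ∈ P.endSide S) : v ∉ S := by
  obtain ⟨N, hN⟩ := h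
  exact (hN N le_rfl).left_notMem

theorem disjoint_endSide : Disjoint S (P.endSide S) :=
  Set.disjoint_left.2 fun _ h h' => notMem_of_mem_endSide h' h

theorem endSide_of_joinedOff (h : v ∈ P.endSide S) (huv : G.JoinedOff S v u) :
    u ∈ P.endSide S := by
  obtain ⟨N, hN⟩ := h
  exact ⟨N, fun n hn => huv.symm.trans (hN n hn)⟩

theorem endSide_of_adj (h : v ∈ P.endSide S) (huv : G.Adj v u) (hu : u ∉ S) :
    u ∈ P.endSide S :=
  endSide_of_joinedOff h (JoinedOff.of_adj huv (notMem_of_mem_endSide h) hu)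

theorem joinedOff_of_mem_endSide (hu : u ∈ P.endSide S) (hv : v ∈ P.endSide S) :
    G.JoinedOff S u v := by
  obtain ⟨N, hN⟩ := hu
  obtain ⟨M, hM⟩ := hv
  exact (hN (max N M) (le_max_left _ _)).trans (hM (max N M) (le_max_right _ _)).symm

theorem exists_componentCompl (P : G.Ray) (hS : S.Finite) :
    ∃ C : G.ComponentCompl S, (C : Set V) = P.endSide S ∧
      ∃ N, ∀ n, N ≤ n → P.vert n ∈ (C : Set V) := by
  obtain ⟨N, C, hC⟩ := P.exists_tail hS
  refine ⟨C, Set.Subset.antisymm (fun v hv => ⟨N, fun n hn => ?_⟩) ?_, N, hC⟩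
  · exact JoinedOff.of_componentCompl hv (hC n hn)
  · rintro v ⟨M, hM⟩
    exact (hM (max N M) (le_max_right _ _)).symm.mem_componentCompl (hC _ (le_max_left _ _))

theorem exists_tail_mem_endSide (P : G.Ray) (hS : S.Finite) :
    ∃ N, ∀ n, N ≤ n → P.vert n ∈ P.endSide S := by
  obtain ⟨C, hC, h⟩ := P.exists_componentCompl hS
  rwa [← hC]

/-- A walk off `T` that starts in the side of `T` never leaves that side, so it also avoids `S`. -/
theorem endSide_subset (h : Disjoint S (P.endSide T)) : P.endSide T ⊆ P.endSide S := by
  rintro v hv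
  obtain ⟨N, hN⟩ := id hv
  refine ⟨N, fun n hn => ((hN n hn).within (X := P.endSide T) ?_ hv).mono ?_⟩
  · exact fun x hx y hxy hy => endSide_of_adj hx hxy hy
  · exact fun x hx => Or.inr fun hx' => Set.disjoint_left.1 h hx hx'

theorem equivalent_iff_infinite :
    Equivalent P Q ↔ ∀ S : Set V, S.Finite → (P.endSide S ∩ Q.support).Infinite := by
  refine forall₂_congr fun S hS => ?_
  obtain ⟨C, hC, N, hN⟩ := P.exists_componentCompl hS
  rw [← hC]
  constructor
  · rintro ⟨D, hP, hQ⟩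
    obtain rfl := P.eq_of_infinite hN hP
    exact hQ
  · exact fun h => ⟨C, P.infinite_of_tail hN, h⟩

theorem Equivalent.symm (h : Equivalent P Q) : Equivalent Q P :=
  equivalent_equivalence.symm h

theorem Equivalent.endSide_eq (h : Equivalent P Q) (hS : S.Finite) :
    P.endSide S = Q.endSide S := by
  obtain ⟨C, hC, N, hN⟩ := P.exists_componentCompl hS
  obtain ⟨D, hD, M, hM⟩ := Q.exists_componentCompl hS
  obtain ⟨E, hE, hE'⟩ := h S hS
  rw [← hC, ← hD, ← P.eq_of_infinite hN hE, ← Q.eq_of_infinite hM hE']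

theorem Equivalent.exists_tail_mem (h : Equivalent P Q) (hS : S.Finite) :
    ∃ N, ∀ n, N ≤ n → Q.vert n ∈ P.endSide S := by
  rw [h.endSide_eq hS]
  exact Q.exists_tail_mem_endSide hS

/-- A ray that starts outside and ends inside of the side of an end meets the separator. -/
theorem exists_mem_of_notMem_of_mem {m n : ℕ} (hmn : m ≤ n) (hm : Q.vert m ∉ P.endSide S)
    (hn : Q.vert n ∈ P.endSide S) : ∃ l, m ≤ l ∧ l < n ∧ Q.vert l ∈ S := by
  by_contra! h
  refine hm (endSide_of_joinedOff hn (Q.joinedOff_of_forall hmn fun l h₁ h₂ => ?_).symm)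
  rcases h₂.lt_or_eq with h' | rfl
  exacts [h l h₁ h', notMem_of_mem_endSide hn]

/-- The image of a ray under an automorphism. -/
def map (g : G ≃g G) (P : G.Ray) : G.Ray where
  vert n := g • P.vert n
  injective := (MulAction.injective g).comp P.injective
  adj n := g.map_rel_iff.2 (P.adj n)

theorem smul_endSide (g : G ≃g G) (P : G.Ray) (S : Set V) :
    g • P.endSide S = (P.map g).endSide (g • S) := by
  ext v
  rw [Set.mem_smul_set_iff_inv_smul_mem]
  refine exists_congr fun N => forall₂_congr fun n _ => ⟨fun h => ?_, fun h => ?_⟩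
  · simpa [map] using h.smul g
  · simpa [map] using h.smul g⁻¹

theorem support_map (g : G ≃g G) (P : G.Ray) : (P.map g).support = g • P.support := by
  simp [support, map, Set.smul_set_range]

theorem Equivalent.map (g : G ≃g G) (h : Equivalent P Q) : Equivalent (P.map g) (Q.map g) := by
  rw [equivalent_iff_infinite] at h ⊢
  intro S hS
  have := (h (g⁻¹ • S) (hS.smul_set)).smul_set (a := g)
  rwa [Set.smul_set_inter, smul_endSide, smul_inv_smul, ← support_map] at this

end Ray

end SimpleGraph

/-! ### Transversals of families of finite sets -/

/-- If no set with fewer than `m` elements meets all members of a family of finite sets, then the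
same holds for a finite subfamily. -/
theorem Finset.exists_finite_subfamily_forall_disjoint {α : Type*} (m : ℕ) :
    ∀ 𝓟 : Set (Finset α), (∀ T : Finset α, T.card < m → ∃ p ∈ 𝓟, Disjoint p T) →
      ∃ 𝓕 ⊆ 𝓟, 𝓕.Finite ∧ ∀ T : Finset α, T.card < m → ∃ p ∈ 𝓕, Disjoint p T := by
  classical
  induction m with
  | zero => exact fun 𝓟 _ => ⟨∅, by simp, by simp, by simp⟩
  | succ m ih =>
    intro 𝓟 h
    obtain ⟨p, hp, -⟩ := h ∅ (by simp)
    -- Adding `v` to a set with fewer than `m` elements leaves fewer than `m + 1`, so the members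
    -- avoiding `v` satisfy the hypothesis for `m`.
    have key : ∀ v, ∃ 𝓕 ⊆ {q ∈ 𝓟 | v ∉ q}, 𝓕.Finite ∧
        ∀ T : Finset α, T.card < m → ∃ q ∈ 𝓕, Disjoint q T := fun v => by
      refine ih _ fun T hT => ?_
      obtain ⟨q, hq, hqT⟩ := h (insert v T) ((Finset.card_insert_le v T).trans_lt (by omega))
      rw [Finset.disjoint_insert_right] at hqT
      exact ⟨q, ⟨hq, hqT.1⟩, hqT.2⟩
    choose 𝓕 h𝓕 hfin hT using key
    refine ⟨insert p (⋃ v ∈ p, 𝓕 v), ?_, ?_, fun T hTm => ?_⟩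
    · refine Set.insert_subset hp (Set.iUnion₂_subset fun v _ q hq => (h𝓕 v hq).1)
    · exact (p.finite_toSet.biUnion fun v _ => hfin v).insert p
    · by_cases hpT : Disjoint p T
      · exact ⟨p, Set.mem_insert _ _, hpT⟩
      · obtain ⟨v, hv, hvT⟩ := Finset.not_disjoint_iff.1 hpT
        obtain ⟨q, hq, hqT⟩ := hT v (T.erase v) (by have := Finset.card_erase_lt_of_mem hvT; omega)
        refine ⟨q, Set.mem_insert_of_mem _ (Set.mem_biUnion hv hq), ?_⟩
        rw [← Finset.insert_erase hvT, Finset.disjoint_insert_right]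
        exact ⟨(h𝓕 v hq).2, hqT⟩

/-- `T` meets every member of the family `𝓟`, and every element of `T` is needed for this. -/
def Finset.IsTightTransversal {α : Type*} (𝓟 : Set (Finset α)) (T : Finset α) : Prop :=
  (∀ p ∈ 𝓟, ∃ v ∈ T, v ∈ p) ∧ ∀ v ∈ T, ∃ p ∈ 𝓟, v ∈ p ∧ ∀ w ∈ T, w ∈ p → w = v

/-- A family of finite sets has only finitely many tight transversals of a given size. -/
theorem Finset.finite_setOf_isTightTransversal {α : Type*} (k : ℕ) :
    ∀ 𝓟 : Set (Finset α), {T : Finset α | T.card = k ∧ T.IsTightTransversal 𝓟}.Finite := by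
  classical
  induction k with
  | zero =>
    refine fun 𝓟 => (Set.finite_singleton ∅).subset ?_
    rintro T ⟨hT, -⟩
    simpa using hT
  | succ k ih =>
    intro 𝓟
    rcases 𝓟.eq_empty_or_nonempty with rfl | ⟨p, hp⟩
    · refine Set.finite_empty.subset ?_
      rintro T ⟨hT, -, h⟩
      obtain ⟨v, hv⟩ := Finset.card_pos.1 (by omega : 0 < T.card)
      obtain ⟨q, hq, -⟩ := h v hv
      exact hq
    -- A transversal contains one of the finitely many `v ∈ p`. Without `v` it is a tight
    -- transversal of the members avoiding `v`: a member witnessing the need for another element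
    -- misses `v`.
    · refine (p.finite_toSet.biUnion fun v _ =>
        (ih {q ∈ 𝓟 | v ∉ q}).image (fun T => insert v T)).subset ?_
      rintro T ⟨hT, hmeet, htight⟩
      obtain ⟨v, hv, hvp⟩ := hmeet p hp
      refine Set.mem_biUnion (Finset.mem_coe.2 hvp) ⟨T.erase v, ⟨?_, ?_, ?_⟩, Finset.insert_erase hv⟩
      · rw [Finset.card_erase_of_mem hv]
        omega
      · rintro q ⟨hq, hvq⟩
        obtain ⟨w, hw, hwq⟩ := hmeet q hq
        exact ⟨w, Finset.mem_erase.2 ⟨fun h => hvq (h ▸ hwq), hw⟩, hwq⟩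
      · intro w hw
        obtain ⟨hwv, hw⟩ := Finset.mem_erase.1 hw
        obtain ⟨q, hq, hwq, h⟩ := htight w hw
        exact ⟨q, ⟨hq, fun hvq => hwv (h v hv hvq).symm⟩, hwq,
          fun x hx => h x (Finset.mem_of_mem_erase hx)⟩

/-! ### Menger linkages from Hall's theorem, and glueing them to rays -/

namespace SimpleGraph

variable {V : Type*} {G : SimpleGraph V}

/-- If fewer than `|A|` vertices cannot separate `A` from `B` within the finite set `F`, then
`A` is linked into `B` within `F`; the paths are given by their successor function. -/
theorem exists_linkage [DecidableEq V] (F A B : Finset V)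
    (h : ∀ T : Finset V, T.card < A.card → ∃ a ∈ A, ∃ b ∈ B, G.JoinedOff (T ∪ (F : Set V)ᶜ) a b) :
    ∃ f : V → V, Set.InjOn f (F \ B : Finset V) ∧
      ∀ v ∈ F \ B, f v ∈ F \ A ∧ (f v = v ∨ G.Adj v (f v)) := by
  classical
  -- The choice `w = v` lets the vertices off the paths be matched to themselves.
  let t : {v // v ∈ F \ B} → Finset V := fun v =>
    (F \ A).filter fun w => w = v ∨ G.Adj v w
  have hall : ∀ s : Finset {v // v ∈ F \ B}, s.card ≤ (s.biUnion t).card := by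
    intro s
    set W : Finset V := s.map (Function.Embedding.subtype _) with hW
    set N : Finset V := F.filter fun w => ∃ v ∈ W, w = v ∨ G.Adj v w with hN
    have hWF : ∀ v ∈ W, v ∈ F \ B := by
      intro v hv
      obtain ⟨x, -, rfl⟩ := Finset.mem_map.1 hv
      exact x.2
    have hWN : W ⊆ N := fun v hv =>
      Finset.mem_filter.2 ⟨(Finset.mem_sdiff.1 (hWF v hv)).1, v, hv, Or.inl rfl⟩
    have ht : s.biUnion t = N \ A := by
      ext w
      simp only [t, hN, hW, Finset.mem_biUnion, Finset.mem_filter, Finset.mem_sdiff,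
        Finset.mem_map, Function.Embedding.subtype_apply]
      constructor
      · rintro ⟨v, hv, ⟨h₁, h₂⟩, h₃⟩
        exact ⟨⟨h₁, v, ⟨v, hv, rfl⟩, h₃⟩, h₂⟩
      · rintro ⟨⟨h₁, _, ⟨v, hv, rfl⟩, h₃⟩, h₂⟩
        exact ⟨v, hv, ⟨h₁, h₂⟩, h₃⟩
    have hcard : s.card = W.card := (Finset.card_map _).symm
    rw [ht, hcard]
    by_contra! hlt
    -- A violation `|N \ A| < |W|` of Hall's condition gives a separator that is too small: a walk
    -- in `F` from `A` avoiding it starts in `W` and cannot leave `W`, which misses `B`.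
    have hT : ((A \ N) ∪ (N \ W)).card < A.card := by
      have h₁ := Finset.card_union_le (A \ N) (N \ W)
      have h₂ := Finset.card_sdiff_add_card_inter A N
      have h₃ := Finset.card_sdiff_add_card_inter N A
      have h₄ := Finset.card_sdiff_add_card_eq_card hWN
      rw [Finset.inter_comm] at h₃
      omega
    obtain ⟨a, ha, b, hb, hab⟩ := h _ hT
    have haW : a ∈ W := by
      have := hab.left_notMem
      simp only [Finset.coe_union, Finset.coe_sdiff, Set.mem_union, Set.mem_sdiff, Finset.mem_coe,
        Set.mem_compl_iff] at this
      tauto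
    have hbW : b ∈ (W : Set V) := by
      refine hab.mem_of_closed (fun x hx y hxy hy => ?_) haW
      simp only [Finset.coe_union, Finset.coe_sdiff, Set.mem_union, Set.mem_sdiff, Finset.mem_coe,
        Set.mem_compl_iff, not_or, not_and, not_not] at hy
      exact hy.1.2 (Finset.mem_filter.2 ⟨hy.2, x, hx, Or.inr hxy⟩)
    exact (Finset.mem_sdiff.1 (hWF b hbW)).2 hb
  obtain ⟨f, hf, hft⟩ := (Finset.all_card_le_biUnion_card_iff_exists_injective t).1 hall
  refine ⟨fun v => if hv : v ∈ F \ B then f ⟨v, hv⟩ else v, ?_, ?_⟩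
  · intro v hv w hw hvw
    simp only [Finset.mem_coe.1 hv, Finset.mem_coe.1 hw, dif_pos] at hvw
    exact congrArg Subtype.val (hf hvw)
  · intro v hv
    simpa only [hv, dif_pos, t, Finset.mem_filter] using hft ⟨v, hv⟩

/-- Glueing injective successor functions of consecutive finite regions yields disjoint rays. -/
theorem exists_disjoint_rays {D : ℕ → Set V} {f : ℕ → V → V} {A : Set V}
    (hfin : ∀ n, (D n).Finite) (hD : Pairwise fun m n => Disjoint (D m) (D n))
    (hE : Pairwise fun m n => Disjoint (f m '' D m) (f n '' D n))
    (hinj : ∀ n, Set.InjOn (f n) (D n)) (hmaps : ∀ n, ∀ v ∈ D n, f n v ∈ D n ∪ D (n + 1))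
    (hadj : ∀ n, ∀ v ∈ D n, f n v = v ∨ G.Adj v (f n v))
    (hA : A ⊆ D 0) (hAE : ∀ n, Disjoint A (f n '' D n)) :
    ∃ R : A → G.Ray, (Pairwise fun a b => Disjoint (R a).support (R b).support) ∧
      (∀ a, (R a).vert 0 = a) ∧ ∀ a m, ∃ N, ∀ n, N ≤ n → ∃ j, m ≤ j ∧ (R a).vert n ∈ D j := by
  classical
  let F : V → V := fun v => if h : ∃ n, v ∈ D n then f h.choose v else v
  have hF : ∀ n, ∀ v ∈ D n, F v = f n v := by
    intro n v hv
    have h : ∃ n, v ∈ D n := ⟨n, hv⟩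
    have : h.choose = n := by
      by_contra hne
      exact Set.disjoint_left.1 (hD hne) h.choose_spec hv
    simp only [F, dif_pos h, this]
  have hFU : ∀ v ∈ ⋃ n, D n, F v ∈ ⋃ n, D n := by
    intro v hv
    obtain ⟨n, hn⟩ := Set.mem_iUnion.1 hv
    rw [hF n v hn]
    rcases hmaps n v hn with h | h
    exacts [Set.mem_iUnion.2 ⟨_, h⟩, Set.mem_iUnion.2 ⟨_, h⟩]
  have hFinj : Set.InjOn F (⋃ n, D n) := by
    intro v hv w hw hvw
    obtain ⟨n, hn⟩ := Set.mem_iUnion.1 hv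
    obtain ⟨m, hm⟩ := Set.mem_iUnion.1 hw
    rw [hF n v hn, hF m w hm] at hvw
    obtain rfl : n = m := by
      by_contra hne
      exact Set.disjoint_left.1 (hE hne) ⟨v, hn, rfl⟩ ⟨w, hm, hvw.symm⟩
    exact hinj n hn hm hvw
  have hAF : ∀ a ∈ A, ∀ v ∈ ⋃ n, D n, F v ≠ a := by
    rintro a ha v hv rfl
    obtain ⟨n, hn⟩ := Set.mem_iUnion.1 hv
    exact Set.disjoint_left.1 (hAE n) ha ⟨v, hn, (hF n v hn).symm⟩
  have hiter : ∀ i, ∀ a ∈ A, F^[i] a ∈ ⋃ n, D n := by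
    intro i a ha
    induction i with
    | zero => exact Set.mem_iUnion.2 ⟨0, hA ha⟩
    | succ i ih =>
      rw [Function.iterate_succ_apply']
      exact hFU _ ih
  -- Since `F` is injective and never returns to `A`, equal iterates can be traced back to their
  -- starting points.
  have hkey : ∀ i j, ∀ a ∈ A, ∀ b ∈ A, F^[i] a = F^[j] b → i = j ∧ a = b := by
    intro i
    induction i with
    | zero =>
      rintro (_ | j) a ha b hb h
      · exact ⟨rfl, h⟩
      · rw [Function.iterate_succ_apply'] at h
        exact (hAF a ha _ (hiter j b hb) h.symm).elim
    | succ i ih =>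
      rintro (_ | j) a ha b hb h
      · rw [Function.iterate_succ_apply'] at h
        exact (hAF b hb _ (hiter i a ha) h).elim
      · rw [Function.iterate_succ_apply', Function.iterate_succ_apply'] at h
        obtain ⟨rfl, rfl⟩ := ih j a ha b hb (hFinj (hiter i a ha) (hiter j b hb) h)
        exact ⟨rfl, rfl⟩
  let R : A → G.Ray := fun a =>
    { vert := fun i => F^[i] a
      injective := fun i j h => (hkey i j a a.2 a a.2 h).1
      adj := fun i => by
        obtain ⟨n, hn⟩ := Set.mem_iUnion.1 (hiter i a a.2)
        -- A fixed point of `F` on an orbit would repeat a vertex, so here the successor is a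
        -- genuine neighbour.
        have hne : F^[i + 1] (a : V) ≠ F^[i] a := fun h => by
          have := (hkey _ _ a a.2 a a.2 h).1
          omega
        rw [Function.iterate_succ_apply'] at hne ⊢
        rw [hF n _ hn] at hne ⊢
        exact (hadj n _ hn).resolve_left hne }
  refine ⟨R, fun a b hab => ?_, fun a => rfl, fun a m => ?_⟩
  · refine Set.disjoint_left.2 ?_
    rintro _ ⟨i, rfl⟩ ⟨j, hj⟩
    exact hab (Subtype.ext (hkey j i b b.2 a a.2 hj).2.symm)
  -- An injective sequence leaves the finite union of the first `m` regions for good.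
  · have hfin' : ((R a).vert ⁻¹' ⋃ j ∈ Set.Iio m, D j).Finite :=
      ((Set.finite_Iio m).biUnion fun j _ => hfin j).preimage (R a).injective.injOn
    obtain ⟨M, hM⟩ := hfin'.bddAbove
    refine ⟨M + 1, fun n hn => ?_⟩
    obtain ⟨j, hj⟩ := Set.mem_iUnion.1 (hiter n a a.2)
    refine ⟨j, ?_, hj⟩
    by_contra! hjm
    have := hM (Set.mem_biUnion (Set.mem_Iio.2 hjm) hj : n ∈ (R a).vert ⁻¹' ⋃ j ∈ Set.Iio m, D j)
    omega

/-! ### Balls in locally finite graphs -/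

section Ball

variable [G.LocallyFinite] [DecidableEq V]

/-- The set of vertices at distance at most `n` from `Z`. -/
def ballAround (G : SimpleGraph V) [G.LocallyFinite] (Z : Finset V) : ℕ → Finset V
  | 0 => Z
  | n + 1 => ballAround G Z n ∪ (ballAround G Z n).biUnion fun v => G.neighborFinset v

variable {Z : Finset V} {u v : V} {m n : ℕ}

theorem ballAround_mono (hmn : m ≤ n) : G.ballAround Z m ⊆ G.ballAround Z n :=
  monotone_nat_of_le_succ (f := G.ballAround Z) (fun _ => Finset.subset_union_left) hmn

theorem subset_ballAround : Z ⊆ G.ballAround Z n :=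
  ballAround_mono (Nat.zero_le n)

theorem mem_ballAround_of_adj (hu : u ∈ G.ballAround Z n) (huv : G.Adj u v) :
    v ∈ G.ballAround Z (n + 1) :=
  Finset.mem_union_right _ (Finset.mem_biUnion.2 ⟨u, hu, (G.mem_neighborFinset u v).2 huv⟩)

theorem mem_ballAround_of_walk (hu : u ∈ G.ballAround Z n) (p : G.Walk u v) :
    v ∈ G.ballAround Z (n + p.length) := by
  induction p generalizing n with
  | nil => exact hu
  | cons h p ih =>
    have := ih (mem_ballAround_of_adj hu h)
    rwa [Walk.length_cons, Nat.add_comm p.length 1, ← Nat.add_assoc]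

theorem exists_joinedOff_of_mem_ballAround (hv : v ∈ G.ballAround Z n) :
    ∃ u ∈ Z, G.JoinedOff (G.ballAround Z n : Set V)ᶜ u v := by
  induction n generalizing v with
  | zero => exact ⟨v, hv, JoinedOff.refl (by simpa using hv)⟩
  | succ n ih =>
    have hsub : (G.ballAround Z (n + 1) : Set V)ᶜ ⊆ (G.ballAround Z n : Set V)ᶜ :=
      Set.compl_subset_compl.2 (Finset.coe_subset.2 (ballAround_mono n.le_succ))
    rcases Finset.mem_union.1 hv with h | h
    · obtain ⟨u, hu, huv⟩ := ih h
      exact ⟨u, hu, huv.mono hsub⟩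
    · obtain ⟨w, hw, hwv⟩ := Finset.mem_biUnion.1 h
      obtain ⟨u, hu, huw⟩ := ih hw
      refine ⟨u, hu, (huw.mono hsub).trans (JoinedOff.of_adj ((G.mem_neighborFinset w v).1 hwv) ?_ ?_)⟩
      · simpa using ballAround_mono n.le_succ hw
      · simpa using hv

end Ball

/-! ### Disjoint rays versus small separators -/

namespace Ray

variable {P Q : G.Ray}

/-- There are `m` disjoint rays in the end of `P`. -/
def HasDisjointFamily (P : G.Ray) (m : ℕ) : Prop :=
  ∃ R : Fin m → G.Ray, (∀ i, Equivalent P (R i)) ∧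
    Pairwise fun i j => Disjoint (R i).support (R j).support

theorem joinedOff_empty (P : G.Ray) (m n : ℕ) : G.JoinedOff ∅ (P.vert m) (P.vert n) := by
  rcases le_total m n with h | h
  · exact P.joinedOff_of_forall h (by simp)
  · exact (P.joinedOff_of_forall h (by simp)).symm

theorem joinedOff_empty_of_mem_endSide {S : Set V} {v : V} (h : v ∈ P.endSide S) (n : ℕ) :
    G.JoinedOff ∅ (P.vert n) v := by
  obtain ⟨N, hN⟩ := h
  exact (P.joinedOff_empty n N).trans ((hN N le_rfl).mono (Set.empty_subset _)).symm

/-- `S` has minimum size among the sets that separate `Z` from the end of `P`. -/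
def IsMinSeparator (P : G.Ray) (Z S : Finset V) : Prop :=
  Disjoint (Z : Set V) (P.endSide S) ∧
    ∀ T : Finset V, Disjoint (Z : Set V) (P.endSide T) → S.card ≤ T.card

theorem exists_isMinSeparator (P : G.Ray) (Z : Finset V) : ∃ S, P.IsMinSeparator Z S := by
  obtain ⟨S, hS, hmin⟩ := exists_minimalFor_of_wellFoundedLT
    (fun T : Finset V => Disjoint (Z : Set V) (P.endSide T)) Finset.card ⟨Z, disjoint_endSide⟩
  refine ⟨S, hS, fun T hT => ?_⟩
  rcases le_total S.card T.card with h | h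
  exacts [h, hmin hT h]

/-- Separating `S` from the end also separates `Z` from it, so minimality passes from `Z` to `S`. -/
theorem IsMinSeparator.card_le {Z S T : Finset V} (h : P.IsMinSeparator Z S)
    (hT : Disjoint (S : Set V) (P.endSide T)) : S.card ≤ T.card :=
  h.2 T (h.1.mono_right (endSide_subset hT))

/-- A vertex of `S` with no neighbour in the side could be dropped without enlarging the side. -/
theorem IsMinSeparator.exists_adj {Z S : Finset V} (h : P.IsMinSeparator Z S) {s : V}
    (hs : s ∈ S) : ∃ y ∈ P.endSide S, G.Adj y s := by
  classical
  by_contra! hno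
  have hsub : P.endSide (S.erase s : Finset V) ⊆ P.endSide S := by
    intro v hv
    obtain ⟨N, hN⟩ := hv
    obtain ⟨M, hM⟩ := P.exists_tail_mem_endSide S.finite_toSet
    refine (hN (max N M) (le_max_left _ _)).symm.mem_of_closed (fun x hx y hxy hy => ?_)
      (hM _ (le_max_right _ _))
    refine endSide_of_adj hx hxy fun hyS => ?_
    obtain rfl : y = s := by
      by_contra hne
      exact hy (Finset.mem_coe.2 (Finset.mem_erase.2 ⟨hne, hyS⟩))
    exact hno x hx hxy
  have := h.2 _ (h.1.mono_right hsub)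
  have := Finset.card_erase_lt_of_mem hs
  omega

/-- If `S'` were not reached from `S` inside the region between them, the reachable vertices
together with everything outside `S` and its side would be closed under steps off `T`. A walk off
`T` from `S` to a tail of `P` would then never get past `S'`. -/
theorem exists_joinedOff_between {S S' T : Set V} (hS' : S'.Finite)
    (hsub : S' ∪ P.endSide S' ⊆ P.endSide S) (hST : ¬ Disjoint S (P.endSide T)) :
    ∃ a ∈ S, ∃ b ∈ S', G.JoinedOff (T ∪ ((S ∪ P.endSide S)ᶜ ∪ P.endSide S')) a b := by
  by_contra! hno
  obtain ⟨a, haS, haT⟩ := Set.not_disjoint_iff.1 hST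
  have hSnot : ∀ x ∈ S, x ∉ P.endSide S' := fun x hx hx' =>
    notMem_of_mem_endSide (hsub (Or.inr hx')) hx
  set Y : Set V := T ∪ ((S ∪ P.endSide S)ᶜ ∪ P.endSide S') with hY
  obtain ⟨N, hN⟩ := haT
  obtain ⟨M, hM⟩ := P.exists_tail_mem_endSide hS'
  have hmem : P.vert (max N M) ∈ P.endSide S' := hM _ (le_max_right _ _)
  have := (hN (max N M) (le_max_left _ _)).mem_of_closed
    (X := (S ∪ P.endSide S)ᶜ ∪ {x | ∃ a ∈ S, G.JoinedOff Y a x}) ?_ ?_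
  · rcases this with h | ⟨a, -, h⟩
    · exact h (Or.inr (hsub (Or.inr hmem)))
    · exact h.right_notMem (Or.inr (Or.inr hmem))
  · intro x hx y hxy hyT
    by_cases hy : y ∈ S ∪ P.endSide S
    · refine Or.inr ?_
      rcases hx with hx | ⟨a, ha, hax⟩
      · have hyS : y ∈ S := by
          by_contra hyS
          have hyC := hy.resolve_left hyS
          by_cases hxS : x ∈ S
          · exact hx (Or.inl hxS)
          · exact hx (Or.inr (endSide_of_adj hyC hxy.symm hxS))
        refine ⟨y, hyS, JoinedOff.refl ?_⟩
        rintro (h | h | h)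
        exacts [hyT h, h hy, hSnot y hyS h]
      · refine ⟨a, ha, hax.trans (JoinedOff.of_adj hxy hax.right_notMem ?_)⟩
        rintro (h | h | h)
        · exact hyT h
        · exact h hy
        · by_cases hxS : x ∈ S'
          · exact hno a ha x hxS hax
          · exact hax.right_notMem (Or.inr (Or.inr (endSide_of_adj h hxy.symm hxS)))
    · exact Or.inl hy
  · refine Or.inr ⟨a, haS, JoinedOff.refl ?_⟩
    rintro (h | h | h)
    exacts [(hN N le_rfl).left_notMem h, h (Or.inl haS), hSnot a haS h]

/-- The region between `S` and `S'` may be infinite, but finitely many walks suffice to defeat all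
`T` with fewer than `|S|` elements. Their union with `S` serves as the finite set `F`. -/
theorem exists_linkage_between [DecidableEq V] {S S' : Finset V}
    (hmin : ∀ T : Finset V, Disjoint (S : Set V) (P.endSide T) → S.card ≤ T.card)
    (hsub : (S' : Set V) ∪ P.endSide S' ⊆ P.endSide S) :
    ∃ F : Finset V, S ⊆ F ∧ (F : Set V) ⊆ (S ∪ P.endSide S) \ P.endSide S' ∧
      ∃ f : V → V, Set.InjOn f (F \ S' : Finset V) ∧
        ∀ v ∈ F \ S', f v ∈ F \ S ∧ (f v = v ∨ G.Adj v (f v)) := by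
  let Y : Set V := ((S : Set V) ∪ P.endSide S)ᶜ ∪ P.endSide S'
  let 𝓟 : Set (Finset V) := {q | (∀ x ∈ q, x ∉ Y) ∧ ∃ a ∈ S, ∃ b ∈ S', ∃ p : G.Walk a b,
    p.support.toFinset = q}
  obtain ⟨𝓕, h𝓕, hfin, hT⟩ := Finset.exists_finite_subfamily_forall_disjoint S.card 𝓟
    fun T hT => by
      obtain ⟨a, ha, b, hb, p, hp⟩ := exists_joinedOff_between (P := P) S'.finite_toSet
        hsub fun h => (hmin T h).not_gt hT
      refine ⟨p.support.toFinset, ⟨fun x hx h => hp x (List.mem_toFinset.1 hx) (Or.inr h),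
        a, ha, b, hb, p, rfl⟩, Finset.disjoint_left.2 fun x hx h => ?_⟩
      exact hp x (List.mem_toFinset.1 hx) (Or.inl h)
  have hF : ∀ q ∈ 𝓕, q ⊆ S ∪ hfin.toFinset.biUnion id := fun q hq =>
    (Finset.subset_biUnion_of_mem id (hfin.mem_toFinset.2 hq)).trans Finset.subset_union_right
  refine ⟨S ∪ hfin.toFinset.biUnion id, Finset.subset_union_left, ?_, exists_linkage _ _ _ ?_⟩
  · intro x hx
    rcases Finset.mem_union.1 (Finset.mem_coe.1 hx) with hx | hx
    · exact ⟨Or.inl hx, fun hx' => notMem_of_mem_endSide (hsub (Or.inr hx')) hx⟩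
    · obtain ⟨q, hq, hxq⟩ := Finset.mem_biUnion.1 hx
      have := (h𝓕 (hfin.mem_toFinset.1 hq)).1 x hxq
      exact ⟨not_not.1 fun h => this (Or.inl h), fun h => this (Or.inr h)⟩
  · intro T hTS
    obtain ⟨q, hq, hqT⟩ := hT T hTS
    obtain ⟨-, a, ha, b, hb, p, rfl⟩ := h𝓕 hq
    refine ⟨a, ha, b, hb, p, fun x hx => ?_⟩
    have hx := List.mem_toFinset.2 hx
    rintro (h | h)
    exacts [Finset.disjoint_left.1 hqT hx h, h (hF _ hq hx)]

/-- If an end contains no `k + 1` disjoint rays, then every finite set can be separated from it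
by at most `k` vertices. -/
theorem exists_separator [G.LocallyFinite] {k : ℕ} (h : ¬ P.HasDisjointFamily (k + 1))
    (Z : Finset V) : ∃ S : Finset V, S.card ≤ k ∧ Disjoint (Z : Set V) (P.endSide S) := by
  classical
  by_contra! hZ
  apply h
  choose M hM using P.exists_isMinSeparator
  -- The ball around `S` pushes the next separator strictly into the side of `S`; the growing balls
  -- around `P.vert 0` make the sides shrink to nothing.
  let next : ℕ → Finset V → Finset V := fun n S =>
    M (G.ballAround S 1 ∪ G.ballAround {P.vert 0} n)
  obtain ⟨S, hS₀, hSsucc⟩ : ∃ S : ℕ → Finset V, P.IsMinSeparator Z (S 0) ∧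
      ∀ n, P.IsMinSeparator (G.ballAround (S n) 1 ∪ G.ballAround {P.vert 0} n) (S (n + 1)) :=
    ⟨fun n => Nat.rec (M Z) next n, hM Z, fun n => hM _⟩
  have hmin : ∀ n, ∀ T : Finset V, Disjoint (S n : Set V) (P.endSide T) →
      (S n).card ≤ T.card := by
    rintro (_ | n) T hT
    exacts [hS₀.card_le hT, (hSsucc n).card_le hT]
  have hball : ∀ n, ∀ x ∈ G.ballAround (S n) 1, x ∉ P.endSide (S (n + 1)) := fun n x hx =>
    Set.disjoint_left.1 (hSsucc n).1 (Finset.mem_coe.2 (Finset.mem_union_left _ hx))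
  have hball' : ∀ n, ∀ x ∈ G.ballAround {P.vert 0} n, x ∉ P.endSide (S (n + 1)) := fun n x hx =>
    Set.disjoint_left.1 (hSsucc n).1 (Finset.mem_coe.2 (Finset.mem_union_right _ hx))
  have hCsub : ∀ n, P.endSide (S (n + 1)) ⊆ P.endSide (S n) := fun n =>
    endSide_subset (Set.disjoint_left.2 fun x hx => hball n x (subset_ballAround hx))
  have hsub : ∀ n, (S (n + 1) : Set V) ∪ P.endSide (S (n + 1)) ⊆ P.endSide (S n) := by
    refine fun n => Set.union_subset (fun s hs => ?_) (hCsub n)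
    obtain ⟨y, hy, hys⟩ := (hSsucc n).exists_adj hs
    refine endSide_of_adj (hCsub n hy) hys fun hsn => ?_
    exact hball n y (mem_ballAround_of_adj (n := 0) hsn hys.symm) hy
  have hanti : Antitone fun n => P.endSide (S n) := antitone_nat_of_succ_le hCsub
  have hanti' : Antitone fun n => (S n : Set V) ∪ P.endSide (S n) :=
    antitone_nat_of_succ_le fun n => (hsub n).trans Set.subset_union_right
  choose F hSF hF f hf using fun n => exists_linkage_between (hmin n) (hsub n)
  have hlt : ∀ {m n}, m < n → (S n : Set V) ∪ P.endSide (S n) ⊆ P.endSide (S m) :=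
    fun {m n} hmn => (hanti' (Nat.succ_le_of_lt hmn)).trans (hsub m)
  have hDC : ∀ n, ∀ x ∈ ((F n \ S (n + 1) : Finset V) : Set V), x ∈ (S n : Set V) ∪ P.endSide (S n) ∧
      x ∉ (S (n + 1) : Set V) ∪ P.endSide (S (n + 1)) := by
    intro n x hx
    obtain ⟨hxF, hxS⟩ := Finset.mem_sdiff.1 (Finset.mem_coe.1 hx)
    exact ⟨(hF n hxF).1, fun h => h.elim hxS (hF n hxF).2⟩
  have hEC : ∀ n, ∀ x ∈ f n '' ((F n \ S (n + 1) : Finset V) : Set V), x ∈ P.endSide (S n) ∧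
      x ∉ P.endSide (S (n + 1)) := by
    rintro n _ ⟨x, hx, rfl⟩
    obtain ⟨hxF, hxS⟩ := Finset.mem_sdiff.1 ((hf n).2 x hx).1
    exact ⟨(hF n hxF).1.resolve_left hxS, (hF n hxF).2⟩
  have hD : Pairwise fun m n => Disjoint ((F m \ S (m + 1) : Finset V) : Set V)
      ((F n \ S (n + 1) : Finset V) : Set V) := by
    refine (pairwise_disjoint_on _).2 fun m n hmn => Set.disjoint_left.2 fun x hx hx' => ?_
    exact (hDC m x hx).2 (hanti' (Nat.succ_le_of_lt hmn) (hDC n x hx').1)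
  have hE : Pairwise fun m n => Disjoint (f m '' ((F m \ S (m + 1) : Finset V) : Set V))
      (f n '' ((F n \ S (n + 1) : Finset V) : Set V)) := by
    refine (pairwise_disjoint_on _).2 fun m n hmn => Set.disjoint_left.2 fun x hx hx' => ?_
    exact (hEC m x hx).2 (hanti (Nat.succ_le_of_lt hmn) (hEC n x hx').1)
  have hmaps : ∀ n, ∀ v ∈ ((F n \ S (n + 1) : Finset V) : Set V), f n v ∈
      ((F n \ S (n + 1) : Finset V) : Set V) ∪ ((F (n + 1) \ S (n + 1 + 1) : Finset V) : Set V) := by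
    intro n v hv
    have hfv := Finset.mem_sdiff.1 ((hf n).2 v hv).1
    by_cases hS : f n v ∈ S (n + 1)
    · refine Or.inr (Finset.mem_coe.2 (Finset.mem_sdiff.2 ⟨hSF _ hS, fun h => ?_⟩))
      exact notMem_of_mem_endSide (hsub (n + 1) (Or.inl h)) hS
    · exact Or.inl (Finset.mem_coe.2 (Finset.mem_sdiff.2 ⟨hfv.1, hS⟩))
  have hA : (S 0 : Set V) ⊆ ((F 0 \ S (0 + 1) : Finset V) : Set V) := by
    intro a ha
    refine Finset.mem_coe.2 (Finset.mem_sdiff.2 ⟨hSF 0 ha, fun h => ?_⟩)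
    exact notMem_of_mem_endSide (hsub 0 (Or.inl h)) ha
  have hAE : ∀ n, Disjoint (S 0 : Set V) (f n '' ((F n \ S (n + 1) : Finset V) : Set V)) := by
    refine fun n => Set.disjoint_left.2 fun x hx hx' => ?_
    exact notMem_of_mem_endSide (hanti (Nat.zero_le n) (hEC n x hx').1) hx
  obtain ⟨R, hR, -, htail⟩ := exists_disjoint_rays (G := G)
    (D := fun n => ((F n \ S (n + 1) : Finset V) : Set V)) (fun n => Finset.finite_toSet _) hD hE
    (fun n => (hf n).1) hmaps (fun n v hv => ((hf n).2 v hv).2) hA hAE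
  have hequiv : ∀ a, Equivalent P (R a) := by
    refine fun a => equivalent_iff_infinite.2 fun Y hY => ?_
    -- A walk from `P.vert 0` to `y` puts `y` in a ball that a later separator cuts off, so no
    -- vertex lies in all sides.
    have hex : ∀ y, ∃ n, y ∉ P.endSide (S n) := by
      intro y
      by_contra! hy
      obtain ⟨p, -⟩ := joinedOff_empty_of_mem_endSide (hy 0) 0
      exact hball' _ y (mem_ballAround_of_walk (n := 0) (Finset.mem_singleton_self _) p) (hy _)
    choose ν hν using hex
    obtain ⟨n, hn⟩ := (hY.image ν).bddAbove
    have hYn : P.endSide (S n) ⊆ P.endSide Y := by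
      refine endSide_subset (Set.disjoint_left.2 fun y hy hy' => hν y ?_)
      exact hanti (hn ⟨y, hy, rfl⟩) hy'
    obtain ⟨N, hN⟩ := htail a (n + 1)
    refine ((Set.Ici_infinite N).image (R a).injective.injOn).mono ?_
    rintro _ ⟨i, hi, rfl⟩
    obtain ⟨j, hj, hjD⟩ := hN i hi
    exact ⟨hYn (hlt (Nat.lt_of_succ_le hj) (hDC j _ hjD).1), i, rfl⟩
  -- By assumption `Z` has no separator of size at most `k`, so enough rays start in `S 0`.
  have hcard : k + 1 ≤ (S 0).card := by
    by_contra! hlt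
    exact hZ (S 0) (Nat.le_of_lt_succ hlt) hS₀.1
  let e : Fin (k + 1) → (S 0 : Set V) := fun i => (S 0).equivFin.symm (Fin.castLE hcard i)
  have he : Function.Injective e :=
    (S 0).equivFin.symm.injective.comp (Fin.castLE_injective hcard)
  exact ⟨fun i => R (e i), fun i => hequiv _, fun i j hij => hR (he.ne hij)⟩

/-! ### Degrees and their invariance under automorphisms -/

theorem le_degree_iff {m : ℕ} :
    (m : ℕ∞) ≤ RayEnd.degree (Quotient.mk (setoid G) P) ↔ P.HasDisjointFamily m := by
  constructor
  · intro h
    obtain ⟨F, ⟨hF, hdisj⟩, hcard⟩ : ∃ F ∈ {F : Set G.Ray |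
        F ⊆ RayEnd.rays (Quotient.mk (setoid G) P) ∧ F.PairwiseDisjoint support},
        (m : ℕ∞) ≤ F.encard := by
      -- A supremum of values below `m + 1` is at most `m`, so a single family already attains the
      -- bound.
      cases m with
      | zero => exact ⟨∅, by simp, by simp⟩
      | succ m =>
        by_contra! hlt
        have : RayEnd.degree (Quotient.mk (setoid G) P) ≤ m :=
          iSup₂_le fun F hF => Order.le_of_lt_add_one (by simpa using hlt F hF)
        have := h.trans this
        norm_cast at this
        omega
    obtain ⟨F', hF', hcard'⟩ := Set.exists_subset_encard_eq hcard
    have hfin : F'.Finite := Set.finite_of_encard_eq_coe hcard'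
    have hn : hfin.toFinset.card = m := by
      rw [hfin.encard_eq_coe_toFinset_card] at hcard'
      exact_mod_cast hcard'
    let e := hfin.toFinset.equivFinOfCardEq hn
    have he : ∀ i, (e.symm i : G.Ray) ∈ F' := fun i => hfin.mem_toFinset.1 (e.symm i).2
    refine ⟨fun i => (e.symm i : G.Ray), fun i => ?_, fun i j hij => ?_⟩
    · exact Quotient.exact (hF (hF' (he i))).symm
    · exact hdisj (hF' (he i)) (hF' (he j))
        fun h => hij (e.symm.injective (Subtype.ext h))
  · rintro ⟨R, hR, hdisj⟩
    have hinj : Function.Injective R := by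
      intro i j hij
      by_contra hne
      have h : Disjoint (R i).support (R j).support := hdisj hne
      rw [hij] at h
      exact Set.disjoint_left.1 h ⟨0, rfl⟩ ⟨0, rfl⟩
    have hcard : (Set.range R).encard = m := by
      rw [← Set.image_univ, hinj.encard_image]
      simp
    rw [← hcard]
    refine le_iSup₂_of_le (Set.range R) ⟨?_, ?_⟩ le_rfl
    · rintro _ ⟨i, rfl⟩
      exact Quotient.sound (hR i).symm
    · rintro _ ⟨i, rfl⟩ _ ⟨j, rfl⟩ hij
      exact hdisj fun h => hij (congrArg R h)

theorem degree_eq_iff {k : ℕ} : RayEnd.degree (Quotient.mk (setoid G) P) = k ↔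
    P.HasDisjointFamily k ∧ ¬ P.HasDisjointFamily (k + 1) := by
  rw [← le_degree_iff, ← le_degree_iff, le_antisymm_iff, and_comm]
  refine and_congr_right fun _ => ?_
  rw [not_le, Nat.cast_succ, ENat.lt_natCast_add_one_iff]

theorem map_inv_map (g : G ≃g G) (P : G.Ray) : (P.map g).map g⁻¹ = P := by
  cases P
  simp [map]

theorem HasDisjointFamily.map {m : ℕ} (g : G ≃g G) (h : P.HasDisjointFamily m) :
    (P.map g).HasDisjointFamily m := by
  obtain ⟨R, hR, hdisj⟩ := h
  refine ⟨fun i => (R i).map g, fun i => (hR i).map g, fun i j hij => ?_⟩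
  change Disjoint ((R i).map g).support ((R j).map g).support
  rw [support_map, support_map]
  exact (Set.disjoint_image_iff (MulAction.injective g)).2 (hdisj hij)

theorem degree_map (g : G ≃g G) {k : ℕ} (h : RayEnd.degree (Quotient.mk (setoid G) P) = k) :
    RayEnd.degree (Quotient.mk (setoid G) (P.map g)) = k := by
  rw [degree_eq_iff] at h ⊢
  refine ⟨h.1.map g, fun h' => h.2 ?_⟩
  have := h'.map g⁻¹
  rwa [map_inv_map] at this

theorem Equivalent.joinedOff_empty (h : Equivalent P Q) (m n : ℕ) :
    G.JoinedOff ∅ (P.vert m) (Q.vert n) := by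
  obtain ⟨N, hN⟩ := h.exists_tail_mem Set.finite_empty
  exact (joinedOff_empty_of_mem_endSide (hN N le_rfl) m).trans (Q.joinedOff_empty N n)

/-! ### Cuts meeting each ray once -/

/-- `S` is a set of `k` vertices that separates the end of `P` from the starting vertices of the
rays `R 0, …, R (k - 1)` and meets the ray `R i` exactly in its `t i`-th vertex. -/
structure IsCut {k : ℕ} (P : G.Ray) (R : Fin k → G.Ray) (S : Finset V) (t : Fin k → ℕ) :
    Prop where
  card_eq : S.card = k
  mem : ∀ i, (R i).vert (t i) ∈ S
  exists_eq : ∀ s ∈ S, ∃ i, (R i).vert (t i) = s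
  mem_endSide : ∀ i l, t i < l → (R i).vert l ∈ P.endSide S
  notMem : ∀ i l, l < t i → (R i).vert l ∉ (S : Set V) ∪ P.endSide S

section Cut

variable {k : ℕ} {R : Fin k → G.Ray}

theorem eq_of_vert_eq (hdisj : Pairwise fun i j => Disjoint (R i).support (R j).support)
    {i j : Fin k} {l m : ℕ} (h : (R i).vert l = (R j).vert m) : i = j ∧ l = m := by
  obtain rfl : i = j := by
    by_contra hne
    exact Set.disjoint_left.1 (hdisj hne) ⟨l, rfl⟩ ⟨m, h.symm⟩
  exact ⟨rfl, (R i).injective h⟩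

/-- A separator of at most `k` vertices must be hit by each of the `k` disjoint rays, hence exactly
once by each, with nothing left over. -/
theorem exists_isCut [G.LocallyFinite] (hR : ∀ i, Equivalent P (R i))
    (hdisj : Pairwise fun i j => Disjoint (R i).support (R j).support)
    (hmax : ¬ P.HasDisjointFamily (k + 1)) (Z : Finset V) :
    ∃ S t, IsCut P R S t ∧ Disjoint (Z : Set V) (S ∪ P.endSide S) := by
  classical
  -- Radius 1 keeps `S` itself off `Z`: the successor on its ray of a vertex of `S` lies in the
  -- side, hence not in `Z'`.
  let Z' := G.ballAround (Z ∪ Finset.univ.image fun i => (R i).vert 0) 1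
  obtain ⟨S, hcard, hS⟩ := exists_separator hmax Z'
  have hzero : ∀ i, (R i).vert 0 ∉ P.endSide S := fun i =>
    Set.disjoint_left.1 hS (Finset.mem_coe.2 (subset_ballAround
      (Finset.mem_union_right _ (Finset.mem_image_of_mem _ (Finset.mem_univ i)))))
  have hmeet : ∀ i, ∃ l, (R i).vert l ∈ S := by
    intro i
    obtain ⟨N, hN⟩ := (hR i).exists_tail_mem S.finite_toSet
    obtain ⟨l, -, -, hl⟩ := exists_mem_of_notMem_of_mem (Nat.zero_le N) (hzero i) (hN N le_rfl)
    exact ⟨l, hl⟩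
  choose t ht using hmeet
  have hinj : Function.Injective fun i => (R i).vert (t i) := fun i j h =>
    (eq_of_vert_eq hdisj h).1
  have himage : Finset.univ.image (fun i => (R i).vert (t i)) = S := by
    refine Finset.eq_of_subset_of_card_le ?_ ?_
    · intro x hx
      obtain ⟨i, -, rfl⟩ := Finset.mem_image.1 hx
      exact ht i
    · rwa [Finset.card_image_of_injective _ hinj, Finset.card_univ, Fintype.card_fin]
  have hex : ∀ s ∈ S, ∃ i, (R i).vert (t i) = s := by
    intro s hs
    rw [← himage] at hs
    obtain ⟨i, -, hi⟩ := Finset.mem_image.1 hs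
    exact ⟨i, hi⟩
  have huniq : ∀ i l, (R i).vert l ∈ (S : Set V) → l = t i := by
    intro i l hl
    obtain ⟨j, hj⟩ := hex _ hl
    obtain ⟨rfl, h⟩ := eq_of_vert_eq hdisj hj
    exact h.symm
  have hafter : ∀ i l, t i < l → (R i).vert l ∈ P.endSide S := by
    intro i l hl
    obtain ⟨N, hN⟩ := (hR i).exists_tail_mem S.finite_toSet
    refine endSide_of_joinedOff (hN (max N l) (le_max_left _ _))
      ((R i).joinedOff_of_forall (le_max_right _ _) fun m hm _ hmS => ?_).symm
    have := huniq i m hmS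
    omega
  refine ⟨S, t, ⟨?_, ht, hex, hafter, ?_⟩, ?_⟩
  · rw [← himage, Finset.card_image_of_injective _ hinj, Finset.card_univ, Fintype.card_fin]
  · rintro i l hl (h | h)
    · exact hl.ne (huniq i l h)
    · refine hzero i (endSide_of_joinedOff h
        ((R i).joinedOff_of_forall (Nat.zero_le l) fun m _ hm hmS => ?_).symm)
      have := huniq i m hmS
      omega
  · refine Set.disjoint_left.2 fun x hx => ?_
    have hx' : x ∈ G.ballAround (Z ∪ Finset.univ.image fun i => (R i).vert 0) 0 :=
      Finset.mem_union_left _ hx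
    rintro (h | h)
    · obtain ⟨i, rfl⟩ := hex x h
      exact Set.disjoint_left.1 hS (Finset.mem_coe.2 (mem_ballAround_of_adj hx' ((R i).adj (t i))))
        (hafter i _ (Nat.lt_succ_self _))
    · exact Set.disjoint_left.1 hS (Finset.mem_coe.2 (ballAround_mono zero_le_one hx')) h

end Cut

end Ray

/-! ### Tight separators and translates of cuts -/

/-- `S` is a tight separator of two neighbours of its element `v`. -/
def IsTightAt (G : SimpleGraph V) (S : Finset V) (v : V) : Prop :=
  v ∈ S ∧ ∃ u w, G.Adj v u ∧ G.Adj v w ∧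
    S.IsTightTransversal {q | ∃ p : G.Walk u w, ∀ x, x ∈ q ↔ x ∈ p.support}

theorem finite_setOf_isTightAt [G.LocallyFinite] (k : ℕ) (v : V) :
    {S : Finset V | S.card = k ∧ G.IsTightAt S v}.Finite := by
  have hN : (G.neighborSet v).Finite := Set.toFinite _
  refine (hN.biUnion fun u _ => hN.biUnion fun w _ =>
    Finset.finite_setOf_isTightTransversal k
      {q | ∃ p : G.Walk u w, ∀ x, x ∈ q ↔ x ∈ p.support}).subset ?_
  rintro S ⟨hk, -, u, w, hu, hw, hS⟩
  exact Set.mem_biUnion hu (Set.mem_biUnion hw ⟨hk, hS⟩)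

theorem IsTightAt.smul [DecidableEq V] {S : Finset V} {v : V} (h : G.IsTightAt S v)
    (g : G ≃g G) : G.IsTightAt (g • S) (g • v) := by
  have hwalk : ∀ (g : G ≃g G) (u w : V) (q : Finset V),
      (∃ p : G.Walk u w, ∀ x, x ∈ q ↔ x ∈ p.support) →
      ∃ p : G.Walk (g • u) (g • w), ∀ x, x ∈ g • q ↔ x ∈ p.support := by
    rintro g u w q ⟨p, hp⟩
    refine ⟨p.map g.toHom, fun x => ?_⟩
    have hsupp : (p.map g.toHom).support = p.support.map fun y => g • y := Walk.support_map _ _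
    refine Finset.mem_smul_finset.trans ?_
    rw [show x ∈ (p.map g.toHom).support ↔ _ from (iff_of_eq (congrArg (x ∈ ·) hsupp)).trans
      List.mem_map]
    simp only [hp]
  obtain ⟨hv, u, w, hu, hw, hmeet, htight⟩ := h
  refine ⟨Finset.smul_mem_smul_finset hv, g • u, g • w, g.map_rel_iff.2 hu, g.map_rel_iff.2 hw,
    fun q hq => ?_, fun x hx => ?_⟩
  · have := hwalk g⁻¹ _ _ q hq
    rw [inv_smul_smul, inv_smul_smul] at this
    obtain ⟨y, hy, hyq⟩ := hmeet _ this
    exact ⟨g • y, Finset.smul_mem_smul_finset hy, Finset.mem_inv_smul_finset_iff.1 hyq⟩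
  · obtain ⟨y, hy, rfl⟩ := Finset.mem_smul_finset.1 hx
    obtain ⟨q, hq, hyq, h⟩ := htight y hy
    refine ⟨g • q, hwalk g u w q hq, Finset.smul_mem_smul_finset hyq, fun z hz hzq => ?_⟩
    obtain ⟨z, hz', rfl⟩ := Finset.mem_smul_finset.1 hz
    rw [h z hz' ((Finset.smul_mem_smul_finset_iff g).1 hzq)]

/-- The two neighbours are the predecessor and successor on `R i`. To cross `S` only at its vertex
on `R j`, go back along `R i`, over to the start of `R j`, forward through `S`, and return inside
the side. -/
theorem Ray.IsCut.isTightAt {k : ℕ} {P : G.Ray} {R : Fin k → G.Ray} {S : Finset V} {t : Fin k → ℕ}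
    (h : IsCut P R S t) (hjoin : ∀ i j, G.JoinedOff S ((R i).vert 0) ((R j).vert 0)) (i : Fin k) :
    G.IsTightAt S ((R i).vert (t i)) := by
  classical
  have hpos : ∀ i, 0 < t i := by
    refine fun i => Nat.pos_of_ne_zero fun h0 => (hjoin i i).left_notMem ?_
    have := h.mem i
    rwa [h0] at this
  have hpred : ∀ i, (R i).vert (t i - 1 + 1) = (R i).vert (t i) := fun i => by
    rw [Nat.sub_add_cancel (hpos i)]
  have hbefore : ∀ j, G.JoinedOff S ((R j).vert 0) ((R j).vert (t j - 1)) := fun j =>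
    (R j).joinedOff_of_forall (Nat.zero_le _) fun l _ hl hS =>
      h.notMem j l (by have := hpos j; omega) (Or.inl hS)
  refine ⟨h.mem i, (R i).vert (t i - 1), (R i).vert (t i + 1), ?_, (R i).adj _, ?_, ?_⟩
  · have := (R i).adj (t i - 1)
    rw [hpred] at this
    exact this.symm
  · rintro q ⟨p, hp⟩
    by_contra! hno
    refine h.notMem i (t i - 1) (by have := hpos i; omega) (Or.inr (endSide_of_joinedOff
      (h.mem_endSide i _ (Nat.lt_succ_self _)) (JoinedOff.symm ⟨p, fun x hx hxS => ?_⟩)))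
    exact hno x hxS ((hp x).2 hx)
  · intro s hs
    obtain ⟨j, rfl⟩ := h.exists_eq s hs
    obtain ⟨p, hp⟩ := (hbefore i).symm.trans ((hjoin i j).trans (hbefore j))
    obtain ⟨q, hq⟩ := joinedOff_of_mem_endSide (h.mem_endSide j _ (Nat.lt_succ_self (t j)))
      (h.mem_endSide i _ (Nat.lt_succ_self (t i)))
    have hadj := (R j).adj (t j - 1)
    rw [hpred] at hadj
    refine ⟨(p.append (Walk.cons hadj (Walk.cons ((R j).adj (t j)) q))).support.toFinset,
      ⟨_, fun x => List.mem_toFinset⟩, ?_, fun x hx hxp => ?_⟩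
    · simp [Walk.mem_support_append_iff]
    · rw [List.mem_toFinset, Walk.mem_support_append_iff, Walk.support_cons, Walk.support_cons,
        List.mem_cons, List.mem_cons] at hxp
      rcases hxp with hxp | rfl | rfl | hxp
      · exact (hp x hxp hx).elim
      · exact (hp _ p.end_mem_support hx).elim
      · rfl
      · exact (hq x hxp hx).elim

theorem Ray.exists_cut_translate [G.LocallyFinite] (hG : G.IsQuasiTransitive) {k : ℕ} (hk : 1 ≤ k)
    {P : G.Ray} {R : Fin k → G.Ray} (hR : ∀ i, Equivalent P (R i))
    (hdisj : Pairwise fun i j => Disjoint (R i).support (R j).support)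
    (hmax : ¬ P.HasDisjointFamily (k + 1)) :
    ∃ (S S' : Finset V) (t t' : Fin k → ℕ) (g : G ≃g G), IsCut P R S t ∧ IsCut P R S' t' ∧
      (S' : Set V) ∪ P.endSide S' ⊆ P.endSide S ∧ g • (S : Set V) = S' := by
  classical
  -- `B` contains walks joining the starts of the rays; cuts that avoid it are tight.
  obtain ⟨B, hB⟩ : ∃ B : Finset V, ∀ i j, G.JoinedOff (B : Set V)ᶜ ((R i).vert 0) ((R j).vert 0) := by
    choose p _ using fun i j => ((hR i).symm.joinedOff_empty 0 0).trans
      ((hR j).joinedOff_empty 0 0)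
    refine ⟨Finset.univ.biUnion fun i => Finset.univ.biUnion fun j => (p i j).support.toFinset,
      fun i j => ⟨p i j, fun x hx h => h ?_⟩⟩
    exact Finset.mem_coe.2 (Finset.mem_biUnion.2 ⟨i, Finset.mem_univ i,
      Finset.mem_biUnion.2 ⟨j, Finset.mem_univ j, List.mem_toFinset.2 hx⟩⟩)
  choose M τ hM hMdisj using exists_isCut hR hdisj hmax
  obtain ⟨S, t, hcut, hBS, hSS⟩ : ∃ (S : ℕ → Finset V) (t : ℕ → Fin k → ℕ),
      (∀ n, IsCut P R (S n) (t n)) ∧ (∀ n, Disjoint (B : Set V) (S n ∪ P.endSide (S n))) ∧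
      ∀ n, Disjoint (S n : Set V) (S (n + 1) ∪ P.endSide (S (n + 1))) := by
    -- Each cut avoids `B`, for tightness, and has the previous cut off its side, for nesting.
    let Z : ℕ → Finset V := fun n => Nat.rec B (fun _ Z => B ∪ M Z) n
    refine ⟨fun n => M (Z n), fun n => τ (Z n), fun n => hM _, fun n => ?_, fun n => ?_⟩
    · refine (hMdisj (Z n)).mono_left (Finset.coe_subset.2 ?_)
      cases n with
      | zero => exact Finset.Subset.refl B
      | succ n => exact Finset.subset_union_left
    · exact (hMdisj (Z (n + 1))).mono_left (Finset.coe_subset.2 Finset.subset_union_right)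
  have hsub : ∀ n, (S (n + 1) : Set V) ∪ P.endSide (S (n + 1)) ⊆ P.endSide (S n) := by
    intro n
    have hC : P.endSide (S (n + 1)) ⊆ P.endSide (S n) :=
      endSide_subset ((hSS n).mono_right Set.subset_union_right)
    refine Set.union_subset (fun s hs => ?_) hC
    obtain ⟨i, rfl⟩ := (hcut (n + 1)).exists_eq s hs
    refine endSide_of_adj (hC ((hcut (n + 1)).mem_endSide i _ (Nat.lt_succ_self _)))
      ((R i).adj _).symm fun h => Set.disjoint_left.1 (hSS n) h (Or.inl hs)
  have hanti : Antitone fun n => (S n : Set V) ∪ P.endSide (S n) :=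
    antitone_nat_of_succ_le fun n => (hsub n).trans Set.subset_union_right
  have htight : ∀ n, G.IsTightAt (S n) ((R ⟨0, hk⟩).vert (t n ⟨0, hk⟩)) := fun n =>
    (hcut n).isTightAt (fun i j => (hB i j).mono fun x hx hxB =>
      Set.disjoint_left.1 (hBS n) hxB (Or.inl hx)) ⟨0, hk⟩
  let Ω := MulAction.orbitRel.Quotient (G ≃g G) V
  have : Finite Ω := hG
  have hrep : ∀ v : V, ∃ (o : Ω) (h : G ≃g G), h • v = Quotient.out o := by
    intro v
    refine ⟨Quotient.mk _ v, ?_⟩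
    exact MulAction.orbitRel_apply.1 (Quotient.mk_out (s := MulAction.orbitRel (G ≃g G) V) v)
  choose o h hoh using fun n => hrep ((R ⟨0, hk⟩).vert (t n ⟨0, hk⟩))
  have hfin : (⋃ x : Ω, {T : Finset V | T.card = k ∧ G.IsTightAt T (Quotient.out x)}).Finite :=
    Set.finite_iUnion fun x => finite_setOf_isTightAt k _
  have hmem : ∀ n, h n • S n ∈
      ⋃ x : Ω, {T : Finset V | T.card = k ∧ G.IsTightAt T (Quotient.out x)} := by
    refine fun n => Set.mem_iUnion.2 ⟨o n, ?_, ?_⟩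
    · rw [Finset.card_smul_finset, (hcut n).card_eq]
    · rw [← hoh]
      exact (htight n).smul (h n)
  -- Pigeonhole: moved to orbit representatives, the cuts range over a finite set.
  obtain ⟨m, n, hmn, heq⟩ : ∃ m n, m < n ∧ h m • S m = h n • S n := by
    have := hfin.to_subtype
    obtain ⟨m, n, hne, heq⟩ := Finite.exists_ne_map_eq_of_infinite
      (fun n => (⟨h n • S n, hmem n⟩ :
        ↥(⋃ x : Ω, {T : Finset V | T.card = k ∧ G.IsTightAt T (Quotient.out x)})))
    have heq := congrArg Subtype.val heq
    rcases hne.lt_or_gt with hlt | hlt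
    exacts [⟨m, n, hlt, heq⟩, ⟨n, m, hlt, heq.symm⟩]
  refine ⟨S m, S n, t m, t n, (h n)⁻¹ * h m, hcut m, hcut n,
    (hanti (Nat.succ_le_of_lt hmn)).trans (hsub m), ?_⟩
  rw [mul_smul, ← Finset.coe_smul_finset, heq, Finset.coe_smul_finset, inv_smul_smul]

/-! ### Automorphisms that push a separator away from the end -/

namespace Ray

variable {P : G.Ray}

/-- The automorphism `h` fixes the end of `P` and moves the separator `S` away from this end. -/
structure IsTranslation (P : G.Ray) (h : G ≃g G) (S : Set V) : Prop where
  finite : S.Finite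
  smul_eq : ∀ T : Set V, T.Finite → h • P.endSide T = P.endSide (h • T)
  subset : S ∪ P.endSide S ⊆ h • P.endSide S

namespace IsTranslation

variable {h : G ≃g G} {S : Set V} {s v : V}

theorem pow_smul_endSide (H : P.IsTranslation h S) (n : ℕ) :
    h ^ n • P.endSide S = P.endSide (h ^ n • S) := by
  induction n with
  | zero => simp
  | succ n ih => rw [pow_succ', mul_smul, mul_smul, ih, H.smul_eq _ H.finite.smul_set]

theorem pow_smul_union_subset (H : P.IsTranslation h S) {m n : ℕ} (hmn : m < n) :
    h ^ m • (S ∪ P.endSide S) ⊆ h ^ n • P.endSide S := by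
  induction n, Nat.succ_le_of_lt hmn using Nat.le_induction with
  | base =>
    rw [pow_succ, mul_smul]
    exact Set.smul_set_mono H.subset
  | succ n hn ih =>
    refine (ih (Nat.lt_of_succ_le hn)).trans ?_
    rw [pow_succ, mul_smul]
    exact Set.smul_set_mono (Set.subset_union_right.trans H.subset)

theorem monotone_endSide (H : P.IsTranslation h S) : Monotone fun n : ℕ => h ^ n • P.endSide S :=
  monotone_nat_of_le_succ fun n =>
    (Set.smul_set_mono Set.subset_union_right).trans (H.pow_smul_union_subset n.lt_succ_self)

theorem monotone_union (H : P.IsTranslation h S) :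
    Monotone fun n : ℕ => h ^ n • (S ∪ P.endSide S) :=
  monotone_nat_of_le_succ fun n =>
    (H.pow_smul_union_subset n.lt_succ_self).trans (Set.smul_set_mono Set.subset_union_right)

theorem eq_of_mem_of_mem (H : P.IsTranslation h S) {m n : ℕ} (hm : v ∈ h ^ m • S)
    (hn : v ∈ h ^ n • S) : m = n := by
  have key : ∀ m n : ℕ, m < n → v ∈ h ^ m • S → v ∉ h ^ n • S := by
    intro m n hmn hm hn
    have := H.pow_smul_union_subset hmn (Set.smul_set_mono Set.subset_union_left hm)
    rw [H.pow_smul_endSide] at this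
    exact notMem_of_mem_endSide this hn
  rcases lt_trichotomy m n with hlt | heq | hlt
  exacts [(key m n hlt hm hn).elim, heq, (key n m hlt hn hm).elim]

/-- Otherwise a walk from `v` to `s` would meet all of the infinitely many pairwise disjoint
translates of `S`. -/
theorem exists_forall_mem (H : P.IsTranslation h S) (hs : s ∈ S) (hv : G.JoinedOff ∅ v s) :
    ∃ N : ℕ, ∀ n, N ≤ n → v ∈ h ^ n • P.endSide S := by
  suffices ∃ N : ℕ, v ∈ h ^ N • P.endSide S by
    obtain ⟨N, hN⟩ := this
    exact ⟨N, fun n hn => H.monotone_endSide hn hN⟩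
  by_contra! hno
  obtain ⟨p, -⟩ := hv
  have hmeet : ∀ n : ℕ, ∃ x ∈ p.support, x ∈ h ^ (n + 1) • S := by
    intro n
    by_contra! hp
    refine hno (n + 1) ?_
    have hsn : s ∈ h ^ (n + 1) • P.endSide S := by
      refine H.pow_smul_union_subset n.succ_pos ?_
      rw [pow_zero, one_smul]
      exact Or.inl hs
    rw [H.pow_smul_endSide] at hsn ⊢
    exact endSide_of_joinedOff hsn (JoinedOff.symm ⟨p, hp⟩)
  choose x hxp hx using hmeet
  have hinj : Function.Injective x := fun m n hmn => by
    have := H.eq_of_mem_of_mem (hx m) (hmn ▸ hx n)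
    omega
  exact Set.infinite_range_of_injective hinj
    ((List.finite_toSet p.support).subset (by rintro _ ⟨n, rfl⟩; exact hxp n))

/-- If `h ^ n • w` lies in `Y`, then `h ^ n • s` lies in a ball around `Y` of radius independent of
`n`. The `h ^ n • s` are distinct and the ball is finite. -/
theorem exists_forall_notMem [G.LocallyFinite] (H : P.IsTranslation h S) (hs : s ∈ S)
    {W Y : Set V} (hW : W.Finite) (hY : Y.Finite) (hjoin : ∀ w ∈ W, G.JoinedOff ∅ w s) :
    ∃ N : ℕ, ∀ n, N ≤ n → Disjoint (h ^ n • W) Y := by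
  classical
  have key : ∀ w, ∃ N : ℕ, w ∈ W → ∀ n, N ≤ n → h ^ n • w ∉ Y := by
    intro w
    by_cases hw : w ∈ W
    · obtain ⟨p, -⟩ := hjoin w hw
      have hinj : Function.Injective fun n : ℕ => h ^ n • s := fun m n hmn => by
        have hmn : h ^ m • s = h ^ n • s := hmn
        refine H.eq_of_mem_of_mem (Set.smul_mem_smul_set hs) ?_
        rw [hmn]
        exact Set.smul_mem_smul_set hs
      obtain ⟨M, hM⟩ := ((G.ballAround hY.toFinset p.length).finite_toSet.preimage
        hinj.injOn).bddAbove
      refine ⟨M + 1, fun _ n hn hwY => ?_⟩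
      have := mem_ballAround_of_walk (Z := hY.toFinset) (n := 0) (hY.mem_toFinset.2 hwY)
        (p.map (h ^ n).toHom)
      rw [Walk.length_map, Nat.zero_add] at this
      have : n ≤ M := hM this
      omega
    · exact ⟨0, fun h => (hw h).elim⟩
  choose ν hν using key
  obtain ⟨N, hN⟩ := (hW.image ν).bddAbove
  refine ⟨N, fun n hn => Set.disjoint_left.2 ?_⟩
  rintro _ ⟨w, hw, rfl⟩
  exact hν w hw n ((hN ⟨w, hw, rfl⟩).trans hn)

variable {D : Set V}

/-- Far translates of a finite set in the component of `S` lie in one component off a given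
finite set. -/
theorem exists_forall_joinedOff [G.LocallyFinite] (H : P.IsTranslation h S) (hs : s ∈ S)
    (hD : D.Finite) (hjoin : ∀ x ∈ D, G.JoinedOff ∅ s x) (hhs : G.JoinedOff ∅ s (h • s))
    {Y : Set V} (hY : Y.Finite) :
    ∃ N : ℕ, ∀ m n, N ≤ m → N ≤ n → ∀ x ∈ h ^ m • D, ∀ y ∈ h ^ n • D, G.JoinedOff Y x y := by
  classical
  have hball : ∀ x, G.JoinedOff ∅ s x → ∃ d, x ∈ G.ballAround {s} d := by
    rintro x ⟨p, -⟩
    exact ⟨_, mem_ballAround_of_walk (n := 0) (Finset.mem_singleton_self s) p⟩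
  obtain ⟨d, hd⟩ : ∃ d, ∀ x ∈ insert (h • s) D, x ∈ G.ballAround {s} d := by
    have : ∀ x, ∃ d, x ∈ insert (h • s) D → x ∈ G.ballAround {s} d := by
      intro x
      by_cases hx : x ∈ insert (h • s) D
      · rcases hx with rfl | hx
        · exact (hball _ hhs).imp fun d hd _ => hd
        · exact (hball _ (hjoin x hx)).imp fun d hd _ => hd
      · exact ⟨0, fun h => (hx h).elim⟩
    choose δ hδ using this
    obtain ⟨d, hd⟩ := ((hD.insert (h • s)).image δ).bddAbove
    -- The ball of radius `d` around `s` is connected and contains `h • s`, so consecutive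
    -- translates overlap; far ones avoid `Y`.
    exact ⟨d, fun x hx => ballAround_mono (hd ⟨x, hx, rfl⟩) (hδ x hx)⟩
  have hW : ∀ x ∈ G.ballAround {s} d, G.JoinedOff (G.ballAround {s} d : Set V)ᶜ s x := by
    intro x hx
    obtain ⟨u, hu, hux⟩ := exists_joinedOff_of_mem_ballAround hx
    rwa [Finset.mem_singleton.1 hu] at hux
  obtain ⟨N, hN⟩ := H.exists_forall_notMem hs (G.ballAround {s} d).finite_toSet hY
    fun w hw => ((hW w hw).mono (Set.empty_subset _)).symm
  have hmove : ∀ n, N ≤ n → ∀ x ∈ insert (h • s) D, G.JoinedOff Y (h ^ n • s) (h ^ n • x) := by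
    intro n hn x hx
    refine ((hW x (hd x hx)).smul (h ^ n)).mono fun y hy => ?_
    rw [Set.smul_set_compl]
    exact fun hy' => Set.disjoint_left.1 (hN n hn) hy' hy
  have hbase : ∀ n, N ≤ n → G.JoinedOff Y (h ^ N • s) (h ^ n • s) := by
    intro n hn
    induction n, hn using Nat.le_induction with
    | base => exact JoinedOff.refl (hmove N le_rfl _ (Set.mem_insert _ _)).left_notMem
    | succ n hn ih =>
      refine ih.trans ?_
      rw [pow_succ, mul_smul]
      exact hmove n hn _ (Set.mem_insert _ _)
  have hall : ∀ n, N ≤ n → ∀ x ∈ h ^ n • D, G.JoinedOff Y (h ^ N • s) x := by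
    rintro n hn _ ⟨x, hx, rfl⟩
    exact (hbase n hn).trans (hmove n hn x (Set.mem_insert_of_mem _ hx))
  exact ⟨N, fun m n hm hn x hx y hy => (hall m hm x hx).symm.trans (hall n hn y hy)⟩

/-- A linkage from `S` to `h • S` extends to disjoint rays along the translates of `S`. -/
theorem exists_rays (H : P.IsTranslation h S) (hfin : D.Finite) {f : V → V}
    (hD : D ⊆ h • P.endSide S \ P.endSide S)
    (hE : f '' D ⊆ h • (S ∪ P.endSide S) \ (S ∪ P.endSide S))
    (hinj : Set.InjOn f D) (hadj : ∀ x ∈ D, G.Adj x (f x)) (hmaps : ∀ x ∈ D, f x ∈ D ∪ h • S)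
    (hSD : S ⊆ D) :
    ∃ Q : S → G.Ray, (Pairwise fun a b => Disjoint (Q a).support (Q b).support) ∧
      (∀ a, (Q a).vert 0 = a) ∧ ∀ a m, ∃ N, ∀ n, N ≤ n → ∃ j, m ≤ j ∧ (Q a).vert n ∈ h ^ j • D := by
  have hD' : ∀ n : ℕ, ∀ x ∈ h ^ n • D, x ∈ h ^ (n + 1) • P.endSide S ∧ x ∉ h ^ n • P.endSide S := by
    rintro n _ ⟨x, hx, rfl⟩
    rw [pow_succ, mul_smul]
    exact ⟨Set.smul_mem_smul_set (hD hx).1,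
      fun h' => (hD hx).2 (Set.smul_mem_smul_set_iff.1 h')⟩
  have himage : ∀ n : ℕ, ∀ y ∈ (fun x => h ^ n • f ((h ^ n)⁻¹ • x)) '' (h ^ n • D),
      ∃ x ∈ D, h ^ n • f x = y := by
    rintro n _ ⟨_, ⟨x, hx, rfl⟩, rfl⟩
    exact ⟨x, hx, by simp⟩
  have hE' : ∀ n : ℕ, ∀ y ∈ (fun x => h ^ n • f ((h ^ n)⁻¹ • x)) '' (h ^ n • D),
      y ∈ h ^ (n + 1) • (S ∪ P.endSide S) ∧ y ∉ h ^ n • (S ∪ P.endSide S) := by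
    intro n y hy
    obtain ⟨x, hx, rfl⟩ := himage n y hy
    have := hE ⟨x, hx, rfl⟩
    rw [pow_succ, mul_smul]
    exact ⟨Set.smul_mem_smul_set this.1, fun h' => this.2 (Set.smul_mem_smul_set_iff.1 h')⟩
  refine exists_disjoint_rays (D := fun n : ℕ => h ^ n • D)
    (f := fun n x => h ^ n • f ((h ^ n)⁻¹ • x)) (fun n => hfin.smul_set) ?_ ?_ ?_ ?_ ?_ ?_ ?_
  · refine (pairwise_disjoint_on _).2 fun m n hmn => Set.disjoint_left.2 fun x hx hx' => ?_
    exact (hD' n x hx').2 (H.monotone_endSide (Nat.succ_le_of_lt hmn) (hD' m x hx).1)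
  · refine (pairwise_disjoint_on _).2 fun m n hmn => Set.disjoint_left.2 fun x hx hx' => ?_
    exact (hE' n x hx').2 (H.monotone_union (Nat.succ_le_of_lt hmn) (hE' m x hx).1)
  · rintro n _ ⟨x, hx, rfl⟩ _ ⟨y, hy, rfl⟩ hxy
    simp only [inv_smul_smul, smul_left_cancel_iff] at hxy
    simp only [hinj hx hy hxy]
  · rintro n _ ⟨x, hx, rfl⟩
    simp only [inv_smul_smul]
    rcases hmaps x hx with h' | h'
    · exact Or.inl (Set.smul_mem_smul_set h')
    · refine Or.inr ?_
      rw [pow_succ, mul_smul]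
      exact Set.smul_mem_smul_set (Set.smul_set_mono hSD h')
  · rintro n _ ⟨x, hx, rfl⟩
    simp only [inv_smul_smul]
    exact Or.inr ((h ^ n).map_rel_iff.2 (hadj x hx))
  · simpa using hSD
  · refine fun n => Set.disjoint_left.2 fun x hx hx' => (hE' n x hx').2 ?_
    refine H.monotone_union (Nat.zero_le n) ?_
    simpa using Or.inl hx

end IsTranslation

/-! ### The second end of degree k -/

theorem exists_other_end [G.LocallyFinite] {k : ℕ} (hk : 1 ≤ k) {R : Fin k → G.Ray}
    (hR : ∀ i, Equivalent P (R i))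
    (hdisj : Pairwise fun i j => Disjoint (R i).support (R j).support) {S S' : Finset V}
    {t t' : Fin k → ℕ} (hS : IsCut P R S t) (hS' : IsCut P R S' t')
    (hsub : (S' : Set V) ∪ P.endSide S' ⊆ P.endSide S) {h : G ≃g G}
    (hP : Equivalent P (P.map h)) (hSS' : h • (S' : Set V) = S) :
    ∃ Q : G.Ray, Q.HasDisjointFamily k ∧ ¬ Q.HasDisjointFamily (k + 1) ∧ ¬ Equivalent P Q := by
  classical
  have hsmul : ∀ T : Set V, T.Finite → h • P.endSide T = P.endSide (h • T) := fun T hT => by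
    rw [smul_endSide, hP.endSide_eq hT.smul_set]
  have hCC' : h • P.endSide S' = P.endSide S := by rw [hsmul _ S'.finite_toSet, hSS']
  have H : P.IsTranslation h S' := ⟨S'.finite_toSet, hsmul, by rwa [hCC']⟩
  have htt' : ∀ i, t i < t' i := by
    intro i
    have hmem : (R i).vert (t' i) ∈ P.endSide S := hsub (Or.inl (hS'.mem i))
    by_contra! hle
    rcases hle.lt_or_eq with hlt | heq
    · exact hS.notMem i _ hlt (Or.inr hmem)
    · rw [heq] at hmem
      exact notMem_of_mem_endSide hmem (hS.mem i)
  -- The segments between the cuts, with `S'` but without `S`; `f` steps back along the rays,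
  -- towards `S`.
  let D : Set V := {x | ∃ i l, t i ≤ l ∧ l < t' i ∧ x = (R i).vert (l + 1)}
  have hDfin : D.Finite := by
    refine (Set.finite_iUnion fun i => (Set.finite_Iio (t' i)).image
      fun l => (R i).vert (l + 1)).subset ?_
    rintro x ⟨i, l, -, hl, rfl⟩
    exact Set.mem_iUnion.2 ⟨i, l, hl, rfl⟩
  obtain ⟨f, hf⟩ : ∃ f : V → V, ∀ x ∈ D, ∃ i l, t i ≤ l ∧ l < t' i ∧ x = (R i).vert (l + 1) ∧
      f x = (R i).vert l := by
    have : ∀ x, ∃ y, x ∈ D → ∃ i l, t i ≤ l ∧ l < t' i ∧ x = (R i).vert (l + 1) ∧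
        y = (R i).vert l := by
      intro x
      by_cases hx : x ∈ D
      · obtain ⟨i, l, h₁, h₂, h₃⟩ := hx
        exact ⟨_, fun _ => ⟨i, l, h₁, h₂, h₃, rfl⟩⟩
      · exact ⟨x, fun h => (hx h).elim⟩
    choose f hf using this
    exact ⟨f, hf⟩
  have hSD : (S' : Set V) ⊆ D := by
    intro x hx
    obtain ⟨i, rfl⟩ := hS'.exists_eq x hx
    have := htt' i
    exact ⟨i, t' i - 1, by omega, by omega, by rw [Nat.sub_add_cancel (by omega)]⟩
  have hD : D ⊆ h • P.endSide S' \ P.endSide S' := by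
    rintro x ⟨i, l, h₁, h₂, rfl⟩
    rw [hCC']
    refine ⟨hS.mem_endSide i _ (by omega), fun hx => ?_⟩
    rcases (Nat.succ_le_of_lt h₂).lt_or_eq with hlt | heq
    · exact hS'.notMem i _ hlt (Or.inr hx)
    · rw [Nat.succ_eq_add_one] at heq
      rw [heq] at hx
      exact notMem_of_mem_endSide hx (hS'.mem i)
  obtain ⟨Q, hQdisj, hQzero, hQtail⟩ := H.exists_rays hDfin (f := f) hD (by
      rintro _ ⟨x, hx, rfl⟩
      obtain ⟨i, l, h₁, h₂, rfl, hfx⟩ := hf x hx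
      rw [hfx, Set.smul_set_union, hSS', hCC']
      refine ⟨?_, hS'.notMem i l h₂⟩
      rcases h₁.lt_or_eq with hlt | rfl
      exacts [Or.inr (hS.mem_endSide i l hlt), Or.inl (hS.mem i)])
    (by
      intro x hx y hy hxy
      obtain ⟨i, l, -, -, rfl, hfx⟩ := hf x hx
      obtain ⟨j, m, -, -, rfl, hfy⟩ := hf y hy
      rw [hfx, hfy] at hxy
      obtain ⟨rfl, rfl⟩ := eq_of_vert_eq hdisj hxy
      rfl)
    (by
      intro x hx
      obtain ⟨i, l, -, -, rfl, hfx⟩ := hf x hx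
      rw [hfx]
      exact ((R i).adj l).symm)
    (by
      intro x hx
      obtain ⟨i, l, h₁, h₂, rfl, hfx⟩ := hf x hx
      rw [hfx, hSS']
      rcases h₁.lt_or_eq with hlt | rfl
      · refine Or.inl ⟨i, l - 1, by omega, by omega, ?_⟩
        rw [Nat.sub_add_cancel (by omega)]
      · exact Or.inr (hS.mem i))
    hSD
  obtain ⟨s, hs⟩ : ∃ s, s ∈ S' := ⟨_, hS'.mem ⟨0, hk⟩⟩
  have hRjoin : ∀ i l, G.JoinedOff ∅ s ((R i).vert l) := by
    intro i l
    obtain ⟨j, rfl⟩ := hS'.exists_eq s hs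
    exact ((hR j).joinedOff_empty 0 _).symm.trans ((hR i).joinedOff_empty 0 l)
  have hhs : G.JoinedOff ∅ s (h • s) := by
    have : h • s ∈ (S : Set V) := hSS' ▸ Set.smul_mem_smul_set (Finset.mem_coe.2 hs)
    obtain ⟨j, hj⟩ := hS.exists_eq _ this
    rw [← hj]
    exact hRjoin _ _
  have hequiv : ∀ a b, Equivalent (Q a) (Q b) := by
    refine fun a b => equivalent_iff_infinite.2 fun Y hY => ?_
    obtain ⟨N, hN⟩ := H.exists_forall_joinedOff (Finset.mem_coe.2 hs) hDfin (by
      rintro x ⟨i, l, -, -, rfl⟩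
      exact hRjoin _ _) hhs hY
    obtain ⟨A, hA⟩ := hQtail a N
    obtain ⟨B, hB⟩ := hQtail b N
    refine ((Set.Ici_infinite B).image (Q b).injective.injOn).mono ?_
    rintro _ ⟨m, hm, rfl⟩
    refine ⟨⟨A, fun n hn => ?_⟩, m, rfl⟩
    obtain ⟨i, hi, hi'⟩ := hA n hn
    obtain ⟨j, hj, hj'⟩ := hB m hm
    exact hN j i hj hi _ hj' _ hi'
  have hout : ∀ a m, ∃ N, ∀ n, N ≤ n → (Q a).vert n ∉ h ^ m • P.endSide S' := by
    intro a m
    obtain ⟨N, hN⟩ := hQtail a m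
    refine ⟨N, fun n hn hmem => ?_⟩
    obtain ⟨j, hj, hjD⟩ := hN n hn
    have hmem' := H.monotone_endSide hj hmem
    obtain ⟨x, hx, hxe⟩ := hjD
    rw [← hxe] at hmem'
    exact (hD hx).2 (Set.smul_mem_smul_set_iff.1 hmem')
  refine ⟨Q ⟨s, hs⟩, ?_, ?_, ?_⟩
  · let e := S'.equivFinOfCardEq hS'.card_eq
    exact ⟨fun i => Q (e.symm i), fun i => hequiv _ _,
      fun i j hij => hQdisj (e.symm.injective.ne hij)⟩
  · rintro ⟨T, hT, hTdisj⟩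
    have hstart : ∀ i, ∃ N : ℕ, ∀ n, N ≤ n → (T i).vert 0 ∈ h ^ n • P.endSide S' := by
      intro i
      have hjoin := ((hT i).joinedOff_empty 0 0).symm
      rw [hQzero] at hjoin
      exact H.exists_forall_mem (Finset.mem_coe.2 hs) hjoin
    choose ν hν using hstart
    -- For this `m` every `T i` starts inside `h ^ m • P.endSide S'`, while its end lives outside,
    -- so each `T i` crosses the `k` vertices of `h ^ m • S'`.
    obtain ⟨m, hm⟩ := (Set.finite_range ν).bddAbove
    have hmeet : ∀ i, ∃ l, (T i).vert l ∈ h ^ m • (S' : Set V) := by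
      intro i
      by_contra! hno
      have hfin : (h ^ m • (S' : Set V)).Finite := S'.finite_toSet.smul_set
      obtain ⟨A, hA⟩ := hout ⟨s, hs⟩ m
      obtain ⟨B, hB⟩ := (hT i).exists_tail_mem hfin
      obtain ⟨C, hC⟩ := hB B le_rfl
      refine hA (max A C) (le_max_left _ _) ?_
      have h0 := hν i m (hm ⟨i, rfl⟩)
      rw [H.pow_smul_endSide] at h0 ⊢
      exact endSide_of_joinedOff h0 (((T i).joinedOff_of_forall (Nat.zero_le B)
        fun l _ _ => hno l).trans (hC _ (le_max_right _ _)))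
    choose l hl using hmeet
    have hinj : Function.Injective fun i => (T i).vert (l i) := fun i j hij =>
      (eq_of_vert_eq hTdisj hij).1
    have hle : k + 1 ≤ k := by
      calc k + 1 = (Finset.univ.image fun i => (T i).vert (l i)).card := by
            rw [Finset.card_image_of_injective _ hinj, Finset.card_univ, Fintype.card_fin]
        _ ≤ (h ^ m • S').card := Finset.card_le_card fun x hx => by
            obtain ⟨i, -, rfl⟩ := Finset.mem_image.1 hx
            have := hl i
            rwa [← Finset.coe_smul_finset] at this
        _ = k := by rw [Finset.card_smul_finset, hS'.card_eq]
    omega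
  · intro hPQ
    obtain ⟨A, hA⟩ := hPQ.exists_tail_mem S'.finite_toSet
    obtain ⟨B, hB⟩ := hout ⟨s, hs⟩ 0
    refine hB (max A B) (le_max_right _ _) ?_
    rw [pow_zero, one_smul]
    exact hA _ (le_max_left _ _)

end Ray

end SimpleGraph

theorem proposition4p7 {V : Type*} (G : SimpleGraph V) [G.LocallyFinite]
    (hG : G.IsQuasiTransitive) (k : ℕ) (hk : 1 ≤ k) :
    ¬ ∃! ω : G.RayEnd, ω.degree = (k : ℕ∞) := by
  rintro ⟨ω, hω, huniq⟩
  obtain ⟨P, rfl⟩ := Quotient.exists_rep ω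
  have hfix : ∀ g : G ≃g G, SimpleGraph.Ray.Equivalent P (P.map g) := fun g =>
    (Quotient.exact (huniq _ (SimpleGraph.Ray.degree_map g hω))).symm
  obtain ⟨⟨R, hR, hdisj⟩, hmax⟩ := SimpleGraph.Ray.degree_eq_iff.1 hω
  obtain ⟨S, S', t, t', g, hS, hS', hsub, hg⟩ :=
    SimpleGraph.Ray.exists_cut_translate hG hk hR hdisj hmax
  obtain ⟨Q, hQ, hQmax, hne⟩ := SimpleGraph.Ray.exists_other_end hk hR hdisj hS hS' hsub
    (hfix g⁻¹) (by rw [← hg, inv_smul_smul])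
  exact hne (Quotient.exact (huniq _ (SimpleGraph.Ray.degree_eq_iff.2 ⟨hQ, hQmax⟩)).symm)
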